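/- Fix an infinite set $\mathbb{D}$ of data values. For a finite alphabet $\mathbb{A}$, a data tree over $\mathbb{A}$ is a non-empty finite ordered unranked tree $\mathbf{t}$ each of whose nodes $x$ carries a letter $\mathbf{a}(x)\in\mathbb{A}$ and a datum $\mathbf{d}(x)\in\mathbb{D}$. A bottom-up data automaton (BUDA) is a tuple $\mathcal{A}=(\mathbb{A},\mathbb{B},Q,q_0,\delta)$ with a finite alphabet $\mathbb{A}$, a finite internal alphabet $\mathbb{B}$, a finite set of states $Q$, $q_0\in Q$, and a finite set $\delta$ of transitions $(t,\alpha)$. Here $t$ is a finite conjunction of basic tests and negated basic tests, the basic tests being $p\in Q$, $\mathsf{eq}$, $\langle e\rangle^{=}$, $\langle e\rangle^{\neq}$ ($e$ a regular expression over $\mathbb{A}\times\mathbb{B}$), $\mathsf{root}$, $\mathsf{leaf}$, $a\in\mathbb{A}$, $b\in\mathbb{B}$; and $\alpha$ is a finite non-empty conjunction of basic actions $\mathsf{accept}$, $\mathsf{keep}(p)$, $\mathsf{store}(p)$, $\mathsf{guess}(p)$, $\mathsf{univ}(p)$ with $p\in Q$. Given a data tree and an internal labelling $\mathbf{b}$ of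 its nodes by $\mathbb{B}$, a thread $(q,d)\in Q\times\mathbb{D}$ satisfies at a node $x$ the basic test $p$, $\mathsf{eq}$, $\mathsf{root}$, $\mathsf{leaf}$, $a$, $b$ iff, respectively, $q=p$, $\mathbf{d}(x)=d$, $x$ is the root, $x$ is a leaf, $\mathbf{a}(x)=a$, $\mathbf{b}(x)=b$; it satisfies $\langle e\rangle^{=}$ (resp. $\langle e\rangle^{\neq}$) iff there is a downward path from $x$ to a node $y$ (possibly $y=x$) whose word of labels in $\mathbb{A}\times\mathbb{B}$, both ends included, matches $e$, and $\mathbf{d}(y)=d$ (resp. $\mathbf{d}(y)\neq d$). A run maps each node $x$ to a finite set $\rho(x)\subseteq Q\times\mathbb{D}$ such that: $\rho(x)=\{(q_0,e)\}$ for some $e\in\mathbb{D}$ if $x$ is a leaf; and for every non-root node $x$ with parent $y$ and every $(q,d)\in\rho(x)$ there is $(t,\alpha)\in\delta$ such that $(q,d)$ satisfies $t$ at $x$ and for every conjunct of $\alpha$: if it is $\mathsf{keep}(p)$ then $(p,d)\in\rho(y)$; if $\mathsf{store}(p)$ then $(p,\mathbf{d}(x))\in\rho(y)$; if $\mathsf{guess}(p)$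 then $(p,e)\in\rho(y)$ for some $e\in\mathbb{D}$; if $\mathsf{univ}(p)$ then $(p,e)\in\rho(y)$ for every datum $e$ occurring in the subtree rooted at $x$ ($\mathsf{accept}$ imposes nothing). The run is accepting if for every $(q,d)$ in $\rho$ of the root there is a transition $(t,\mathsf{accept})\in\delta$ such that $(q,d)$ satisfies $t$ at the root. $\mathcal{A}$ accepts a data tree over $\mathbb{A}$ iff for some internal labelling there is an accepting run. Consider a class $\mathcal{C}$ of finitely represented automata, each with a finite alphabet $\mathbb{A}$ and recognizing a set of data trees over $\mathbb{A}$. Say that $\mathcal{C}$ extends BUDA if from every BUDA one can compute an automaton in $\mathcal{C}$ with the same alphabet and the same language; that $\mathcal{C}$ is closed under effective complementation if from every automaton in $\mathcal{C}$ with alphabet $\mathbb{A}$ one can compute an automaton in $\mathcal{C}$ with alphabet $\mathbb{A}$ recognizing the complement of its language in the set of all data trees over $\mathbb{A}$; and that it is closed under effective intersection if from every two automata in $\mathcal{C}$ with the same alphabet one can compute an automaton in $\mathcal{C}$ with this alphabet recognizing the intersection of their languages. **Proposition.** If $\mathcal{C}$ extends BUDA and is closed under effective complementation and effective intersection, then its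 emptiness problem is undecidable: there is no algorithm that, given an automaton in $\mathcal{C}$, decides whether its language is empty. -/

import Mathlib

/-! ### Finite ordered unranked trees and data trees -/

/-- A (non-empty) finite ordered unranked tree over `E`. A position is the list of child indices
leading to it from the root `[]`; children are numbered from `0`. -/
structure UTree (E : Type*) where
  pos : Finset (List ℕ)
  root_mem : [] ∈ pos
  prefix_closed : ∀ x i, x ++ [i] ∈ pos → x ∈ pos
  sibling_closed : ∀ x i, x ++ [i + 1] ∈ pos → x ++ [i] ∈ pos
  label : {x // x ∈ pos} → E

namespace UTree

variable {E : Type*} (T : UTree E)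

/-- The nodes of the tree. -/
abbrev Node : Type := {x // x ∈ T.pos}

def root : T.Node := ⟨[], T.root_mem⟩

/-- `y` is the parent of `x`. -/
def IsParent (y x : T.Node) : Prop := ∃ i : ℕ, x.1 = y.1 ++ [i]

def IsLeaf (x : T.Node) : Prop := ∀ y : T.Node, ¬ T.IsParent x y

/-- `DownPath T ℓ x w y`: there is a downward path from `x` to `y` (going from parent to child at
every step, possibly with `x = y`) whose sequence of labels under `ℓ`, both ends included,
is `w`. -/
inductive DownPath {F : Type*} (ℓ : T.Node → F) : T.Node → List F → T.Node → Prop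
  | single (x : T.Node) : DownPath ℓ x [ℓ x] x
  | step {x z y : T.Node} {w : List F} :
      T.IsParent x z → DownPath ℓ z w y → DownPath ℓ x (ℓ x :: w) y

end UTree

/-- Data trees over the alphabet with `k` letters and the domain `D` of data values. -/
abbrev DataTree (k : ℕ) (D : Type*) := UTree (Fin k × D)

namespace DataTree

variable {k : ℕ} {D : Type*} (T : DataTree k D)

def letter (x : T.Node) : Fin k := (T.label x).1

def datum (x : T.Node) : D := (T.label x).2

/-- The data values occurring in the subtree rooted at `x`. -/
def dataBelow (x : T.Node) : Set D := {e | ∃ z : T.Node, x.1 <+: z.1 ∧ T.datum z = e}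

end DataTree

/-- A language of data trees, together with its alphabet `{0, …, k - 1}`. -/
abbrev DataLanguage (D : Type*) := Σ k : ℕ, Set (DataTree k D)

/-! ### Syntax of bottom-up data automata -/

namespace Buda

/-- Regular expressions over pairs (letter, internal letter). -/
abbrev Regex := RegularExpression (ℕ × ℕ)

inductive BasicTest where
  | state (p : ℕ)
  | eq
  | pathEq (e : Regex)
  | pathNe (e : Regex)
  | root
  | leaf
  | letter (a : ℕ)
  | internal (b : ℕ)

/-- A basic test or its negation. -/
inductive Literal where
  | pos (t : BasicTest)
  | neg (t : BasicTest)

inductive BasicAction where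
  | accept
  | keep (p : ℕ)
  | store (p : ℕ)
  | guess (p : ℕ)
  | univ (p : ℕ)

/-- A transition: a conjunction of literals and a conjunction of basic actions. -/
abbrev Transition := List Literal × List BasicAction

end Buda

/-- The syntax of bottom-up data automata: the alphabet is `{0, …, numLetters - 1}`, the internal
alphabet is `{0, …, numInternal - 1}`, the set of states is `{0, …, numStates - 1}`.
See `BUDA.WellFormed`. -/
structure BUDA where
  numLetters : ℕ
  numInternal : ℕ
  numStates : ℕ
  init : ℕ
  trans : List Buda.Transition

namespace Buda

/-- All letters of the expression are in `{0, …, k - 1} × {0, …, m - 1}`. -/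
def Regex.InRange (k m : ℕ) : Regex → Prop
  | .zero => True
  | .epsilon => True
  | .char c => c.1 < k ∧ c.2 < m
  | .plus e f => Regex.InRange k m e ∧ Regex.InRange k m f
  | .comp e f => Regex.InRange k m e ∧ Regex.InRange k m f
  | .star e => Regex.InRange k m e

def BasicTest.InRange (k m n : ℕ) : BasicTest → Prop
  | .state p => p < n
  | .eq => True
  | .pathEq e => Regex.InRange k m e
  | .pathNe e => Regex.InRange k m e
  | .root => True
  | .leaf => True
  | .letter a => a < k
  | .internal b => b < m

def Literal.InRange (k m n : ℕ) : Literal → Prop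
  | .pos t => t.InRange k m n
  | .neg t => t.InRange k m n

def BasicAction.InRange (n : ℕ) : BasicAction → Prop
  | .accept => True
  | .keep p => p < n
  | .store p => p < n
  | .guess p => p < n
  | .univ p => p < n

end Buda

/-- The initial state is a state, and transitions mention only states, letters and internal letters
of the automaton; every transition has at least one basic action. -/
structure BUDA.WellFormed (A : BUDA) : Prop where
  init_lt : A.init < A.numStates
  literals : ∀ τ ∈ A.trans, ∀ l ∈ τ.1, l.InRange A.numLetters A.numInternal A.numStates
  actions : ∀ τ ∈ A.trans, ∀ a ∈ τ.2, a.InRange A.numStates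
  actions_ne : ∀ τ ∈ A.trans, τ.2 ≠ []

/-! ### Semantics of bottom-up data automata -/

namespace Buda

section Semantics

variable {k m : ℕ} {D : Type*} (T : DataTree k D) (β : T.Node → Fin m)

/-- The pair of the letter and the internal letter at a node. -/
def fullLetter (x : T.Node) : ℕ × ℕ := ((T.letter x : ℕ), (β x : ℕ))

/-- The thread `(q, d)` makes the basic test true at the node `x` of `T` with internal
labelling `β`. -/
def BasicTest.Holds (x : T.Node) (q : ℕ) (d : D) : BasicTest → Prop
  | .state p => q = p
  | .eq => T.datum x = d
  | .pathEq e => ∃ w y, T.DownPath (fullLetter T β) x w y ∧ w ∈ e.matches' ∧ T.datum y = d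
  | .pathNe e => ∃ w y, T.DownPath (fullLetter T β) x w y ∧ w ∈ e.matches' ∧ T.datum y ≠ d
  | .root => x = T.root
  | .leaf => T.IsLeaf x
  | .letter a => (T.letter x : ℕ) = a
  | .internal b => (β x : ℕ) = b

def Literal.Holds (x : T.Node) (q : ℕ) (d : D) : Literal → Prop
  | .pos t => t.Holds T β x q d
  | .neg t => ¬ t.Holds T β x q d

/-- The basic action, performed at `x` by a thread with register value `d`, is carried out by the
set of threads `S` at the parent of `x`. -/
def BasicAction.Realized (x : T.Node) (d : D) (S : Set (ℕ × D)) : BasicAction → Prop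
  | .accept => True
  | .keep p => (p, d) ∈ S
  | .store p => (p, T.datum x) ∈ S
  | .guess p => ∃ e : D, (p, e) ∈ S
  | .univ p => ∀ e ∈ T.dataBelow x, (p, e) ∈ S

end Semantics

end Buda

namespace BUDA

variable {D : Type*} (A : BUDA)

/-- `ρ` is a run of `A` on the data tree `T` with internal labelling `β`. -/
structure IsRun (T : DataTree A.numLetters D) (β : T.Node → Fin A.numInternal)
    (ρ : T.Node → Set (ℕ × D)) : Prop where
  finite : ∀ x, (ρ x).Finite
  states : ∀ x, ∀ θ ∈ ρ x, θ.1 < A.numStates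
  leaf : ∀ x, T.IsLeaf x → ∃ e : D, ρ x = {(A.init, e)}
  step : ∀ x y, T.IsParent y x → ∀ q d, (q, d) ∈ ρ x →
    ∃ τ ∈ A.trans, (∀ l ∈ τ.1, l.Holds T β x q d) ∧ ∀ a ∈ τ.2, a.Realized T x d (ρ y)

/-- Every thread at the root satisfies the test of a transition whose action is `accept`. -/
def IsAccepting (T : DataTree A.numLetters D) (β : T.Node → Fin A.numInternal)
    (ρ : T.Node → Set (ℕ × D)) : Prop :=
  ∀ q d, (q, d) ∈ ρ T.root →
    ∃ τ ∈ A.trans, (∀ l ∈ τ.1, l.Holds T β T.root q d) ∧ ∀ a ∈ τ.2, a = .accept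

/-- `A` accepts `T`: for some internal labelling of the nodes there is an accepting run. -/
def Accepts (T : DataTree A.numLetters D) : Prop :=
  ∃ (β : T.Node → Fin A.numInternal) (ρ : T.Node → Set (ℕ × D)),
    A.IsRun T β ρ ∧ A.IsAccepting T β ρ

/-- The language of data trees recognized by `A`. -/
def lang (D : Type*) : DataLanguage D := ⟨A.numLetters, {T | A.Accepts T}⟩

end BUDA

/-! ### Effective representation of bottom-up data automata -/

namespace Buda

/-- Gödel numbering of regular expressions. -/
def encodeRegex : Regex → ℕ
  | .zero => 0
  | .epsilon => 1
  | .char c => 4 * Nat.pair c.1 c.2 + 2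
  | .plus e f => 4 * Nat.pair (encodeRegex e) (encodeRegex f) + 3
  | .comp e f => 4 * Nat.pair (encodeRegex e) (encodeRegex f) + 4
  | .star e => 4 * encodeRegex e + 5

def decodeRegex : ℕ → Regex
  | 0 => .zero
  | 1 => .epsilon
  | n + 2 =>
    have hm : n / 4 < n + 2 := by omega
    have _m1 : (n / 4).unpair.1 < n + 2 := lt_of_le_of_lt (n / 4).unpair_left_le hm
    have _m2 : (n / 4).unpair.2 < n + 2 := lt_of_le_of_lt (n / 4).unpair_right_le hm
    match n % 4 with
    | 0 => .char (n / 4).unpair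
    | 1 => .plus (decodeRegex (n / 4).unpair.1) (decodeRegex (n / 4).unpair.2)
    | 2 => .comp (decodeRegex (n / 4).unpair.1) (decodeRegex (n / 4).unpair.2)
    | _ => .star (decodeRegex (n / 4))

theorem decodeRegex_encodeRegex (e : Regex) : decodeRegex (encodeRegex e) = e := by
  induction e with
  | zero => simp [encodeRegex, decodeRegex]
  | epsilon => simp [encodeRegex, decodeRegex]
  | char c =>
    have h1 : 4 * Nat.pair c.1 c.2 / 4 = Nat.pair c.1 c.2 := by omega
    have h2 : 4 * Nat.pair c.1 c.2 % 4 = 0 := by omega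
    rw [encodeRegex, decodeRegex]
    simp only [h1, h2, Nat.unpair_pair]
  | plus e f he hf =>
    rw [encodeRegex]
    generalize hp : Nat.pair (encodeRegex e) (encodeRegex f) = p
    have h1 : (4 * p + 1) / 4 = p := by omega
    have h2 : (4 * p + 1) % 4 = 1 := by omega
    rw [show 4 * p + 3 = (4 * p + 1) + 2 from rfl, decodeRegex]
    simp only [h1, h2]
    simp [← hp, he, hf]
  | comp e f he hf =>
    rw [encodeRegex]
    generalize hp : Nat.pair (encodeRegex e) (encodeRegex f) = p
    have h1 : (4 * p + 2) / 4 = p := by omega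
    have h2 : (4 * p + 2) % 4 = 2 := by omega
    rw [show 4 * p + 4 = (4 * p + 2) + 2 from rfl, decodeRegex]
    simp only [h1, h2]
    simp [← hp, he, hf]
  | star e he =>
    rw [encodeRegex]
    generalize hp : encodeRegex e = p at he ⊢
    have h1 : (4 * p + 3) / 4 = p := by omega
    have h2 : (4 * p + 3) % 4 = 3 := by omega
    rw [show 4 * p + 5 = (4 * p + 3) + 2 from rfl, decodeRegex]
    simp only [h1, h2]
    simp [he]

theorem encodeRegex_decodeRegex (n : ℕ) : encodeRegex (decodeRegex n) = n := by
  induction n using Nat.strong_induction_on with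
  | _ n ih =>
    match n with
    | 0 => simp [encodeRegex, decodeRegex]
    | 1 => simp [encodeRegex, decodeRegex]
    | n + 2 =>
      have hm : n / 4 < n + 2 := by omega
      have m1 : (n / 4).unpair.1 < n + 2 := lt_of_le_of_lt (n / 4).unpair_left_le hm
      have m2 : (n / 4).unpair.2 < n + 2 := lt_of_le_of_lt (n / 4).unpair_right_le hm
      rw [decodeRegex]
      have hlt : n % 4 < 4 := Nat.mod_lt _ (by norm_num)
      have hdiv := Nat.div_add_mod n 4
      generalize hr : n % 4 = r at hlt hdiv ⊢
      interval_cases r <;>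
        simp [encodeRegex, ih _ hm, ih _ m1, ih _ m2, Nat.pair_unpair] <;> omega

instance : Denumerable Regex :=
  Denumerable.mk' ⟨encodeRegex, decodeRegex, decodeRegex_encodeRegex, encodeRegex_decodeRegex⟩

instance : Primcodable Regex := Primcodable.ofDenumerable Regex

def BasicTest.equiv :
    BasicTest ≃ (ℕ ⊕ Unit ⊕ Regex ⊕ Regex ⊕ Unit ⊕ Unit ⊕ ℕ ⊕ ℕ) where
  toFun
    | .state p => .inl p
    | .eq => .inr (.inl ())
    | .pathEq e => .inr (.inr (.inl e))
    | .pathNe e => .inr (.inr (.inr (.inl e)))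
    | .root => .inr (.inr (.inr (.inr (.inl ()))))
    | .leaf => .inr (.inr (.inr (.inr (.inr (.inl ())))))
    | .letter a => .inr (.inr (.inr (.inr (.inr (.inr (.inl a))))))
    | .internal b => .inr (.inr (.inr (.inr (.inr (.inr (.inr b))))))
  invFun
    | .inl p => .state p
    | .inr (.inl ()) => .eq
    | .inr (.inr (.inl e)) => .pathEq e
    | .inr (.inr (.inr (.inl e))) => .pathNe e
    | .inr (.inr (.inr (.inr (.inl ())))) => .root
    | .inr (.inr (.inr (.inr (.inr (.inl ()))))) => .leaf
    | .inr (.inr (.inr (.inr (.inr (.inr (.inl a)))))) => .letter a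
    | .inr (.inr (.inr (.inr (.inr (.inr (.inr b)))))) => .internal b
  left_inv := by rintro (_ | _) <;> rfl
  right_inv := by rintro (_ | _ | _ | _ | _ | _ | _ | _) <;> rfl

instance : Primcodable BasicTest := Primcodable.ofEquiv _ BasicTest.equiv

def Literal.equiv : Literal ≃ (BasicTest ⊕ BasicTest) where
  toFun
    | .pos t => .inl t
    | .neg t => .inr t
  invFun
    | .inl t => .pos t
    | .inr t => .neg t
  left_inv := by rintro (_ | _) <;> rfl
  right_inv := by rintro (_ | _) <;> rfl

instance : Primcodable Literal := Primcodable.ofEquiv _ Literal.equiv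

def BasicAction.equiv : BasicAction ≃ (Unit ⊕ ℕ ⊕ ℕ ⊕ ℕ ⊕ ℕ) where
  toFun
    | .accept => .inl ()
    | .keep p => .inr (.inl p)
    | .store p => .inr (.inr (.inl p))
    | .guess p => .inr (.inr (.inr (.inl p)))
    | .univ p => .inr (.inr (.inr (.inr p)))
  invFun
    | .inl () => .accept
    | .inr (.inl p) => .keep p
    | .inr (.inr (.inl p)) => .store p
    | .inr (.inr (.inr (.inl p))) => .guess p
    | .inr (.inr (.inr (.inr p))) => .univ p
  left_inv := by rintro (_ | _) <;> rfl
  right_inv := by rintro (_ | _ | _ | _ | _) <;> rfl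

instance : Primcodable BasicAction := Primcodable.ofEquiv _ BasicAction.equiv

end Buda

def BUDA.equiv : BUDA ≃ (ℕ × ℕ × ℕ × ℕ × List Buda.Transition) where
  toFun A := (A.numLetters, A.numInternal, A.numStates, A.init, A.trans)
  invFun c := ⟨c.1, c.2.1, c.2.2.1, c.2.2.2.1, c.2.2.2.2⟩
  left_inv _ := rfl
  right_inv _ := rfl

instance : Primcodable BUDA := Primcodable.ofEquiv _ BUDA.equiv

/-! ### Classes of automata on data trees and effective operations -/

/-- A class of automata on data trees over the domain `D`, whose members are finitely represented
by codes in `C`: which codes represent automata, and the language (with its alphabet) of each.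
The set of codes of automata need not be decidable; algorithms on automata are only required to
work on it. -/
structure AutomataClass (C : Type*) (D : Type*) where
  automata : Set C
  lang : C → DataLanguage D

namespace AutomataClass

variable {C : Type*} [Primcodable C] {D : Type*} (M : AutomataClass C D)

/-- The class extends bottom-up data automata: each such automaton can be effectively turned
into a member of the class with the same alphabet and the same language. -/
def ExtendsBUDA : Prop :=
  ∃ f : BUDA →. C, Partrec f ∧
    ∀ A : BUDA, A.WellFormed → ∃ c ∈ f A, c ∈ M.automata ∧ M.lang c = A.lang D

/-- Closure under effective complementation, relative to all data trees over the alphabet of the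
automaton. -/
def ClosedUnderEffectiveCompl : Prop :=
  ∃ f : C →. C, Partrec f ∧
    ∀ c ∈ M.automata, ∃ c' ∈ f c, c' ∈ M.automata ∧ M.lang c' = ⟨(M.lang c).1, (M.lang c).2ᶜ⟩

/-- Closure under effective intersection of automata over the same alphabet. -/
def ClosedUnderEffectiveInter : Prop :=
  ∃ f : C × C →. C, Partrec f ∧
    ∀ c₁ ∈ M.automata, ∀ c₂ ∈ M.automata, ∀ (k : ℕ) (L₁ L₂ : Set (DataTree k D)),
      M.lang c₁ = ⟨k, L₁⟩ → M.lang c₂ = ⟨k, L₂⟩ →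
        ∃ c ∈ f (c₁, c₂), c ∈ M.automata ∧ M.lang c = ⟨k, L₁ ∩ L₂⟩

/-- Decidability of the emptiness problem: some algorithm decides, given an automaton of the class,
whether its language is empty. -/
def EmptinessDecidable : Prop :=
  ∃ g : C →. Bool, Partrec g ∧
    ∀ c ∈ M.automata, ∃ b ∈ g c, (b = true ↔ (M.lang c).2 = ∅)

end AutomataClass

/-! The halting problem reduces to emptiness. An execution of a counter program leaves a word of
instructions: increments, decrements and zero tests. The possible traces of a program form a regular
language, and the program halts iff one of them is executable, that is, all its decrements and zero
tests are legal (`Prog.exists_exec_iff`). Legality is a counting condition, and data values make it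
local: each increment of a counter carries a fresh datum, each decrement reuses the datum of an
earlier increment not yet decremented, and a zero test requires that every incremented datum has
been decremented (`DataValid.valid`, `Valid.dataValid_annotate`). Infinitely many data are needed
for the fresh ones.

Such a data word is written on a unary tree with the latest instruction nearest the root, so that
the past of an instruction is what lies below it and downward path tests can inspect it. A walker
thread climbs from the leaf, leaves at the parent of each instruction the threads that check its
data (`univ` provides one per datum for a zero test), and at the root checks that the word is a
trace of the program on its input (`exists_accepts_iff`).

On branching trees these tests are too weak, since a required occurrence may be found on another
branch. Unarity has to be imposed, and this is what complementation is for: a BUDA recognizes the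
trees that are not unary by guessing two incomparable nodes (`Buda.branching_accepts_iff`).
Complementing it and intersecting with the trace automaton gives an automaton that is empty iff the
program does not halt.

The program is fixed and only its input varies. It searches for a step bound under which a given
code halts; primitive recursive functions are compiled into counter programs by
`Prog.exists_computes`, and unbounded search is added by `Prog.exists_search`. -/

/-! ### Counter programs and their traces -/

namespace Counter

/-- The contents of the counters. -/
abbrev Store := ℕ → ℕ

/-- The residues modulo 3 separate the kinds of instruction, and letter `0` stays free to serve as a
marker. The second component is the internal letter, of which the trace automaton has only one. -/
def incL (r : ℕ) : ℕ × ℕ := (3 * r + 1, 0)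

def decL (r : ℕ) : ℕ × ℕ := (3 * r + 2, 0)

def zeroL (r : ℕ) : ℕ × ℕ := (3 * r + 3, 0)

theorem incL_inj {r r' : ℕ} : incL r = incL r' ↔ r = r' := by
  simp [incL]

theorem decL_inj {r r' : ℕ} : decL r = decL r' ↔ r = r' := by
  simp [decL]

theorem zeroL_inj {r r' : ℕ} : zeroL r = zeroL r' ↔ r = r' := by
  simp [zeroL]

theorem incL_ne_decL (r r' : ℕ) : incL r ≠ decL r' := by
  simp only [incL, decL, ne_eq, Prod.mk.injEq, not_and]; omega

theorem incL_ne_zeroL (r r' : ℕ) : incL r ≠ zeroL r' := by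
  simp only [incL, zeroL, ne_eq, Prod.mk.injEq, not_and]; omega

theorem decL_ne_zeroL (r r' : ℕ) : decL r ≠ zeroL r' := by
  simp only [decL, zeroL, ne_eq, Prod.mk.injEq, not_and]; omega

/-- The effect of an instruction: increment, decrement or zero test of a counter. -/
def Step (c : ℕ × ℕ) (s s' : Store) : Prop :=
  (∃ r, c = incL r ∧ s' = Function.update s r (s r + 1)) ∨
  (∃ r n, c = decL r ∧ s r = n + 1 ∧ s' = Function.update s r n) ∨
  (∃ r, c = zeroL r ∧ s r = 0 ∧ s' = s)

theorem step_incL {r : ℕ} {s s' : Store} :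
    Step (incL r) s s' ↔ s' = Function.update s r (s r + 1) := by
  simp [Step, incL_inj, incL_ne_decL, incL_ne_zeroL]

theorem step_decL {r : ℕ} {s s' : Store} :
    Step (decL r) s s' ↔ ∃ n, s r = n + 1 ∧ s' = Function.update s r n := by
  simp [Step, decL_inj, (incL_ne_decL _ _).symm, decL_ne_zeroL]

theorem step_zeroL {r : ℕ} {s s' : Store} : Step (zeroL r) s s' ↔ s r = 0 ∧ s' = s := by
  simp [Step, zeroL_inj, (incL_ne_zeroL _ _).symm, (decL_ne_zeroL _ _).symm]

/-- `Run s w s'`: executing the instructions of `w`, from the last entry to the first, leads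
from `s` to `s'`. -/
inductive Run : Store → List (ℕ × ℕ) → Store → Prop
  | nil (s : Store) : Run s [] s
  | cons {s s₁ s₂ : Store} {w : List (ℕ × ℕ)} {c : ℕ × ℕ} :
      Run s w s₁ → Step c s₁ s₂ → Run s (c :: w) s₂

theorem run_nil {s s' : Store} : Run s [] s' ↔ s' = s := by
  constructor
  · rintro ⟨⟩; rfl
  · rintro rfl; exact .nil _

theorem run_cons {s s' : Store} {c : ℕ × ℕ} {w : List (ℕ × ℕ)} :
    Run s (c :: w) s' ↔ ∃ s₁, Run s w s₁ ∧ Step c s₁ s' := by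
  constructor
  · rintro ⟨⟩; exact ⟨_, ‹_›, ‹_›⟩
  · rintro ⟨s₁, h, h'⟩; exact .cons h h'

theorem run_append {s s' : Store} {u v : List (ℕ × ℕ)} :
    Run s (u ++ v) s' ↔ ∃ s₁, Run s v s₁ ∧ Run s₁ u s' := by
  induction u generalizing s' with
  | nil => simp [run_nil]
  | cons c u ih =>
    simp only [List.cons_append, run_cons, ih]
    constructor
    · rintro ⟨s₂, ⟨s₁, h1, h2⟩, h3⟩; exact ⟨s₁, h1, s₂, h2, h3⟩
    · rintro ⟨s₁, h1, s₂, h2, h3⟩; exact ⟨s₂, ⟨s₁, h1, h2⟩, h3⟩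

/-- Counter programs; `loop r P` repeats "decrement `r` and execute `P`" until `r` is zero. -/
inductive Prog where
  | skip
  | inc (r : ℕ)
  | seq (P Q : Prog)
  | loop (r : ℕ) (P : Prog)

namespace Prog

/-- The regular expression of the possible traces of a program, latest instruction first. -/
def traces : Prog → Buda.Regex
  | skip => 1
  | inc r => .char (incL r)
  | seq P Q => Q.traces * P.traces
  | loop r P => .char (zeroL r) * (P.traces * .char (decL r)).star

/-- A bound on the counters of a program. -/
def bound : Prog → ℕ
  | skip => 0
  | inc r => r + 1
  | seq P Q => max P.bound Q.bound
  | loop r P => max (r + 1) P.bound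

def Exec (P : Prog) (s s' : Store) : Prop := ∃ w ∈ P.traces.matches', Run s w s'

theorem exec_skip {s s' : Store} : skip.Exec s s' ↔ s' = s := by
  simp [Exec, traces, Language.mem_one, run_nil]

theorem exec_inc {r : ℕ} {s s' : Store} :
    (inc r).Exec s s' ↔ s' = Function.update s r (s r + 1) := by
  simp only [Exec, traces, RegularExpression.matches'_char]
  change (∃ w, w = [incL r] ∧ _) ↔ _
  simp [run_cons, run_nil, step_incL]

theorem exec_seq {P Q : Prog} {s s' : Store} :
    (seq P Q).Exec s s' ↔ ∃ s₁, P.Exec s s₁ ∧ Q.Exec s₁ s' := by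
  simp only [Exec, traces, RegularExpression.matches'_mul, Language.mem_mul]
  constructor
  · rintro ⟨_, ⟨u, hu, v, hv, rfl⟩, h⟩
    obtain ⟨s₁, h1, h2⟩ := run_append.1 h
    exact ⟨s₁, ⟨v, hv, h1⟩, u, hu, h2⟩
  · rintro ⟨s₁, ⟨v, hv, h1⟩, u, hu, h2⟩
    exact ⟨_, ⟨u, hu, v, hv, rfl⟩, run_append.2 ⟨s₁, h1, h2⟩⟩

theorem exec_loop_zero {r : ℕ} {P : Prog} {s : Store} (h : s r = 0) : (loop r P).Exec s s := by
  refine ⟨[zeroL r], ?_, run_cons.2 ⟨s, .nil s, step_zeroL.2 ⟨h, rfl⟩⟩⟩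
  rw [traces, RegularExpression.matches'_mul, Language.mem_mul]
  exact ⟨[zeroL r], rfl, [], Language.nil_mem_kstar _, rfl⟩

theorem exec_loop_succ {r n : ℕ} {P : Prog} {s s₁ s' : Store} (h : s r = n + 1)
    (hP : P.Exec (Function.update s r n) s₁) (hl : (loop r P).Exec s₁ s') :
    (loop r P).Exec s s' := by
  obtain ⟨u, hu, hu'⟩ := hP
  obtain ⟨v, hv, hv'⟩ := hl
  rw [traces, RegularExpression.matches'_mul, Language.mem_mul] at hv
  obtain ⟨z, hz, v, hv, rfl⟩ := hv
  refine ⟨z ++ v ++ (u ++ [decL r]), ?_,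
    run_append.2 ⟨s₁, run_append.2 ⟨_, run_cons.2 ⟨s, .nil s, step_decL.2 ⟨n, h, rfl⟩⟩, hu'⟩, hv'⟩⟩
  rw [traces, RegularExpression.matches'_mul, Language.mem_mul]
  refine ⟨z, hz, v ++ (u ++ [decL r]), ?_, by simp⟩
  rw [RegularExpression.matches'_star] at hv ⊢
  -- Traces are reversed, so the iteration executed first is the last factor of the star, which is
  -- therefore unfolded on the right.
  rw [← Language.one_add_kstar_mul_self_eq_kstar]
  refine Or.inr ⟨v, hv, u ++ [decL r], ?_, rfl⟩
  rw [RegularExpression.matches'_mul]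
  exact ⟨u, hu, [decL r], rfl, rfl⟩

/-- The factors of the starred part of a trace are the iterations, the earliest one last; the
induction removes them from the end. -/
theorem exec_loop_induction {r : ℕ} {P : Prog} {s' : Store} {motive : Store → Prop}
    (zero : s' r = 0 → motive s')
    (succ : ∀ s n s₁, s r = n + 1 → P.Exec (Function.update s r n) s₁ → (loop r P).Exec s₁ s' →
      motive s₁ → motive s) {s : Store} (h : (loop r P).Exec s s') : motive s := by
  obtain ⟨w, hw, hrun⟩ := h
  rw [traces, RegularExpression.matches'_mul, Language.mem_mul] at hw
  obtain ⟨z, hz, v, hv, rfl⟩ := hw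
  obtain rfl : z = [zeroL r] := hz
  rw [RegularExpression.matches'_star, Language.mem_kstar] at hv
  obtain ⟨L, rfl, hL⟩ := hv
  induction L using List.reverseRecOn generalizing s with
  | nil =>
    simp only [List.flatten_nil, List.append_nil, run_cons, run_nil, exists_eq_left,
      step_zeroL] at hrun
    obtain ⟨h, rfl⟩ := hrun
    exact zero h
  | append_singleton L u ih =>
    have hu := hL u (by simp)
    rw [RegularExpression.matches'_mul, Language.mem_mul] at hu
    obtain ⟨p, hp, d, hd, rfl⟩ := hu
    obtain rfl : d = [decL r] := hd
    rw [List.flatten_append, List.flatten_singleton, ← List.append_assoc, run_append] at hrun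
    obtain ⟨s₁, h1, h2⟩ := hrun
    rw [run_append] at h1
    obtain ⟨s₂, h3, h4⟩ := h1
    simp only [run_cons, run_nil, exists_eq_left, step_decL] at h3
    obtain ⟨n, hn, rfl⟩ := h3
    refine succ s n s₁ hn ⟨p, hp, h4⟩ ⟨_, ?_, h2⟩ (ih (fun y hy => hL y (by simp [hy])) h2)
    rw [traces, RegularExpression.matches'_mul, Language.mem_mul]
    exact ⟨_, rfl, _, Language.join_mem_kstar fun y hy => hL y (by simp [hy]), rfl⟩

theorem exec_loop {r : ℕ} {P : Prog} {s s' : Store} :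
    (loop r P).Exec s s' ↔ (s r = 0 ∧ s' = s) ∨
      ∃ n s₁, s r = n + 1 ∧ P.Exec (Function.update s r n) s₁ ∧ (loop r P).Exec s₁ s' := by
  constructor
  · exact exec_loop_induction (motive := fun s => (s r = 0 ∧ s' = s) ∨
      ∃ n s₁, s r = n + 1 ∧ P.Exec (Function.update s r n) s₁ ∧ (loop r P).Exec s₁ s')
      (fun h => Or.inl ⟨h, rfl⟩) (fun s n s₁ h1 h2 h3 _ => Or.inr ⟨n, s₁, h1, h2, h3⟩)
  · rintro (⟨h, rfl⟩ | ⟨n, s₁, h1, h2, h3⟩)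
    · exact exec_loop_zero h
    · exact exec_loop_succ h1 h2 h3

/-- The trace expression leaves the number of iterations open, but the decrement that continues a
loop and the zero test that ends it exclude each other. This lets an assumed execution be identified
with a computed one in `exists_search`. -/
theorem exec_deterministic (P : Prog) {s s₁ s₂ : Store} (h₁ : P.Exec s s₁) (h₂ : P.Exec s s₂) :
    s₁ = s₂ := by
  induction P generalizing s s₁ s₂ with
  | skip => rw [exec_skip] at h₁ h₂; rw [h₁, h₂]
  | inc r => rw [exec_inc] at h₁ h₂; rw [h₁, h₂]
  | seq P Q ihP ihQ =>
    rw [exec_seq] at h₁ h₂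
    obtain ⟨t, h1, h2⟩ := h₁
    obtain ⟨t', h1', h2'⟩ := h₂
    obtain rfl := ihP h1 h1'
    exact ihQ h2 h2'
  | loop r P ih =>
    refine exec_loop_induction (motive := fun s => (loop r P).Exec s s₂ → s₁ = s₂) ?_ ?_ h₁ h₂
    · intro h h'
      rcases exec_loop.1 h' with ⟨_, h'⟩ | ⟨n, _, hn, _⟩
      · exact h'.symm
      · omega
    · intro s n t hn hP _ hm h'
      rcases exec_loop.1 h' with ⟨h0, _⟩ | ⟨n', t', hn', hP', h'⟩
      · omega
      · obtain rfl : n = n' := by omega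
        obtain rfl := ih hP hP'
        exact hm h'

/-! ### Compiling primitive recursive functions and unbounded search -/

open Function

/-- `P` adds the value of `f` at the counters `v` to the counter `o`, using the counters from `b`
on as scratch space. -/
def Computes {n : ℕ} (P : Prog) (f : List.Vector ℕ n → ℕ) (v : Fin n → ℕ) (o b : ℕ) : Prop :=
  ∀ s : Store, (∀ j, b ≤ j → s j = 0) →
    P.Exec s (update s o (s o + f (List.Vector.ofFn fun i => s (v i))))

theorem exec_clear (r : ℕ) (s : Store) : (loop r skip).Exec s (update s r 0) := by
  induction h : s r generalizing s with
  | zero => simpa [← h] using exec_loop_zero (P := skip) h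
  | succ n ih =>
    exact exec_loop_succ h (exec_skip.2 rfl) (by simpa using ih (update s r n) (by simp))

theorem exec_move {r o : ℕ} (hro : r ≠ o) (s : Store) :
    (loop r (inc o)).Exec s (update (update s r 0) o (s o + s r)) := by
  induction h : s r generalizing s with
  | zero =>
    have : update (update s r 0) o (s o + 0) = s := by simp [← h]
    rw [this]; exact exec_loop_zero h
  | succ n ih =>
    refine exec_loop_succ h (exec_inc.2 rfl) ?_
    convert ih _ ?_ using 1
    · funext j
      simp only [update_apply]
      split_ifs <;> simp_all <;> omega
    · simp [hro]

/-- Add `r` to `o`, using the counter `b`. -/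
def copy (r o b : ℕ) : Prog := seq (loop r (seq (inc o) (inc b))) (loop b (inc r))

theorem exec_copy {r o b : ℕ} (hro : r ≠ o) (hrb : r ≠ b) (hob : o ≠ b) (s : Store)
    (hb : s b = 0) : (copy r o b).Exec s (update s o (s o + s r)) := by
  have key : ∀ s : Store, (loop r (seq (inc o) (inc b))).Exec s
      (update (update (update s r 0) o (s o + s r)) b (s b + s r)) := by
    intro s
    induction h : s r generalizing s with
    | zero =>
      have : update (update (update s r 0) o (s o + 0)) b (s b + 0) = s := by
        rw [add_zero, add_zero, ← h]
        simp
      rw [this]; exact exec_loop_zero h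
    | succ n ih =>
      refine exec_loop_succ h (exec_seq.2 ⟨_, exec_inc.2 rfl, exec_inc.2 rfl⟩) ?_
      convert ih _ ?_ using 1
      · funext j
        simp only [update_apply]
        split_ifs <;> simp_all <;> omega
      · simp [hro, hrb]
  refine exec_seq.2 ⟨_, key s, ?_⟩
  convert exec_move hrb.symm _ using 1
  funext j
  simp only [update_apply]
  split_ifs <;> simp_all

/-- Prepares the arguments of a composition: the block of `n` counters from `b` on is filled one
value at a time, with scratch space behind the block. The bound `j < b + n` beside `j < b + l` is
there only to form an index in `Fin n`. -/
theorem exists_computes_family {m n : ℕ} {g : Fin n → List.Vector ℕ m → ℕ} (v : Fin m → ℕ) (b : ℕ)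
    (hv : ∀ i, v i < b) (hg : ∀ i, ∃ P : Prog, P.Computes (g i) v (b + i) (b + n)) :
    ∀ l ≤ n, ∃ P : Prog, ∀ s : Store, (∀ j, b ≤ j → s j = 0) →
      P.Exec s (fun j => if h : b ≤ j ∧ j < b + l ∧ j < b + n then
        g ⟨j - b, by omega⟩ (List.Vector.ofFn fun i => s (v i)) else s j) := by
  intro l
  induction l with
  | zero =>
    refine fun _ => ⟨skip, fun s _ => exec_skip.2 ?_⟩
    funext j
    rw [dif_neg]; omega
  | succ l ih =>
    intro hl
    obtain ⟨P, hP⟩ := ih (by omega)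
    obtain ⟨Q, hQ⟩ := hg ⟨l, hl⟩
    refine ⟨seq P Q, fun s hs => exec_seq.2 ⟨_, hP s hs, ?_⟩⟩
    convert hQ _ ?_ using 1
    · have hin : ∀ i, (if h : b ≤ v i ∧ v i < b + l ∧ v i < b + n then
          g ⟨v i - b, by omega⟩ (List.Vector.ofFn fun i => s (v i)) else s (v i)) = s (v i) :=
        fun i => dif_neg (by have := hv i; omega)
      funext j
      simp only [update_apply, hin]
      by_cases hj : j = b + l
      · subst hj
        simp [hs, show l < n by omega]
      · rw [if_neg hj]
        by_cases hj' : b ≤ j ∧ j < b + l ∧ j < b + n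
        · rw [dif_pos hj', dif_pos (by omega)]
        · rw [dif_neg hj', dif_neg (by omega)]
    · intro j hj
      rw [dif_neg (by omega)]
      exact hs j (by omega)

theorem exists_clear_range (b n : ℕ) : ∃ P : Prog, ∀ s : Store,
    P.Exec s (fun j => if b ≤ j ∧ j < b + n then 0 else s j) := by
  induction n with
  | zero => exact ⟨skip, fun s => exec_skip.2 (by funext j; rw [if_neg]; omega)⟩
  | succ n ih =>
    obtain ⟨P, hP⟩ := ih
    refine ⟨seq P (loop (b + n) skip), fun s => exec_seq.2 ⟨_, hP s, ?_⟩⟩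
    convert exec_clear _ _ using 1
    funext j
    simp only [update_apply]
    split_ifs <;> first | rfl | omega

/-- Every compiled program leaves its arguments intact and its scratch space zero, so programs can
be chained and the induction over primitive recursive definitions goes through with the counters as
parameters. -/
theorem exists_computes {n : ℕ} {f : List.Vector ℕ n → ℕ} (hf : Nat.Primrec' f) (v : Fin n → ℕ)
    (o b : ℕ) (hv : ∀ i, v i < b) (ho : o < b) (hvo : ∀ i, v i ≠ o) :
    ∃ P : Prog, P.Computes f v o b := by
  induction hf generalizing o b with
  | zero => exact ⟨skip, fun s _ => exec_skip.2 (by simp)⟩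
  | succ =>
    refine ⟨seq (copy (v 0) o b) (inc o), fun s hs => exec_seq.2 ⟨_, exec_copy (hvo 0)
      (hv 0).ne ho.ne s (hs b le_rfl), exec_inc.2 ?_⟩⟩
    simp [add_assoc]
  | get i =>
    refine ⟨copy (v i) o b, fun s hs => ?_⟩
    convert exec_copy (hvo i) (hv i).ne ho.ne s (hs b le_rfl) using 1
    simp
  | @comp m n f g _ _ ihf ihg =>
    obtain ⟨P, hP⟩ := exists_computes_family v b hv (g := g) (n := n) (fun i => ihg i v (b + i)
      (b + n) (fun j => by have := hv j; omega) (by omega) (fun j => by have := hv j; omega)) n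
      le_rfl
    obtain ⟨Q, hQ⟩ := ihf (fun i => b + i) o (b + n) (fun i => by omega) (by omega)
      (fun i => by omega)
    obtain ⟨R, hR⟩ := exists_clear_range b n
    refine ⟨seq P (seq Q R), fun s hs => exec_seq.2 ⟨_, hP s hs, exec_seq.2 ⟨_, hQ _ ?_, ?_⟩⟩⟩
    · intro j hj
      rw [dif_neg (by omega)]
      exact hs j (by omega)
    · convert hR _ using 1
      funext j
      simp only [update_apply]
      by_cases hj : b ≤ j ∧ j < b + n
      · rw [if_pos hj, if_neg (by omega)]
        exact hs j hj.1
      · rw [if_neg hj]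
        by_cases hjo : j = o
        · rw [if_pos hjo, if_pos hjo, dif_neg (by omega)]
          congr 2
          simp
        · rw [if_neg hjo, if_neg hjo, dif_neg (by omega)]
  | @prec n f g _ _ ihf ihg =>
    -- Counter `b` holds the iterations left, `b + 1` the recursion index, `b + 2` the value
    -- reached; `b + 3` receives the next value, and scratch space begins at `b + 4`.
    let w : Fin (n + 2) → ℕ := Fin.cons (b + 1) (Fin.cons (b + 2) fun i => v i.succ)
    obtain ⟨F, hF⟩ := ihf (fun i => v i.succ) (b + 2) (b + 4)
      (fun i => by have := hv i.succ; omega) (by omega) (fun i => by have := hv i.succ; omega)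
    obtain ⟨G, hG⟩ := ihg w (b + 3) (b + 4)
      (fun i => by
        refine Fin.cases ?_ (fun i => Fin.cases ?_ (fun i => ?_) i) i <;> simp [w]
        have := hv i.succ; omega) (by omega)
      (fun i => by
        refine Fin.cases ?_ (fun i => Fin.cases ?_ (fun i => ?_) i) i <;> simp [w]
        have := hv i.succ; omega)
    let body : Prog := seq G (seq (loop (b + 2) skip) (seq (loop (b + 3) (inc (b + 2)))
      (inc (b + 1))))
    let val (s : Store) (k : ℕ) : ℕ := Nat.rec (f (List.Vector.ofFn fun i => s (v i.succ)))
      (fun y IH => g (y ::ᵥ IH ::ᵥ List.Vector.ofFn fun i => s (v i.succ))) k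
    -- The loop invariant; a pass through the loop replaces `(c + 1, y)` by `(c, y + 1)`.
    let st (s : Store) (c y : ℕ) : Store :=
      update (update (update s b c) (b + 1) y) (b + 2) (val s y)
    have hvb : ∀ i, v i ≠ b ∧ v i ≠ b + 1 ∧ v i ≠ b + 2 := fun i => by have := hv i; omega
    have hbody : ∀ s : Store, (∀ j, b ≤ j → s j = 0) → ∀ c y,
        body.Exec (st s c y) (st s c (y + 1)) := by
      intro s hs c y
      refine exec_seq.2 ⟨_, hG _ ?_, exec_seq.2 ⟨_, exec_clear _ _, exec_seq.2
        ⟨_, exec_move (by omega) _, exec_inc.2 ?_⟩⟩⟩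
      · intro j hj
        simp only [st, update_apply]
        rw [if_neg (by omega), if_neg (by omega), if_neg (by omega)]
        exact hs j (by omega)
      · have hvec : (List.Vector.ofFn fun i => st s c y (w i)) =
            (y ::ᵥ val s y ::ᵥ List.Vector.ofFn fun i => s (v i.succ)) := by
          simp [List.Vector.ofFn, w, st, hvb]
        rw [hvec]
        funext j
        have h3 := hs (b + 3) (by omega)
        simp only [st, update_apply]
        split_ifs <;> first | omega | (simp_all; done) | simp_all [val]
    have hloop : ∀ s : Store, (∀ j, b ≤ j → s j = 0) → ∀ c y,
        (loop b body).Exec (st s c y) (st s 0 (c + y)) := by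
      intro s hs c
      induction c with
      | zero => intro y; simpa using exec_loop_zero (by simp [st])
      | succ c ih =>
        intro y
        refine exec_loop_succ (n := c) (by simp [st]) ?_
          (by simpa only [show c + 1 + y = c + (y + 1) by omega] using ih (y + 1))
        convert hbody s hs c y using 1
        funext j
        simp only [st, update_apply]
        split_ifs <;> first | rfl | omega
    refine ⟨seq (copy (v 0) b (b + 1)) (seq F (seq (loop b body) (seq (loop (b + 1) skip)
      (loop (b + 2) (inc o))))), fun s hs => exec_seq.2 ⟨_, exec_copy (hvb 0).1 (hvb 0).2.1
      (by omega) s (hs _ (by omega)), exec_seq.2 ⟨st s (s (v 0)) 0, ?_, exec_seq.2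
      ⟨_, hloop s hs _ _, exec_seq.2 ⟨_, exec_clear _ _, ?_⟩⟩⟩⟩⟩
    · convert hF _ ?_ using 1
      · funext j
        have h0 := hs b le_rfl
        have h1 := hs (b + 1) (by omega)
        have h2 := hs (b + 2) (by omega)
        simp only [st, val, update_apply, hvb, if_false]
        split_ifs <;> first | omega | simp_all
      · intro j hj
        rw [update_of_ne (by omega)]
        exact hs j (by omega)
    · convert exec_move (show b + 2 ≠ o by omega) _ using 1
      funext j
      have h0 := hs b le_rfl
      have h1 := hs (b + 1) (by omega)
      have h2 := hs (b + 2) (by omega)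
      simp only [st, val, update_apply, List.Vector.ofFn]
      split_ifs <;> first | omega | simp_all

/-- Unbounded search for a zero of a primitive recursive function with values at most `1`. -/
theorem exists_search {g : ℕ → ℕ → ℕ} (hg : Primrec₂ g) (hg1 : ∀ k n, g k n ≤ 1) :
    ∃ P : Prog, ∀ n, (∃ s', P.Exec (update (fun _ => 0) 0 n) s') ↔ ∃ k, g k n = 0 := by
  obtain ⟨Q, hQ⟩ := exists_computes (Nat.Primrec'.prim_iff₂.2 hg) ![1, 0] 2 3
    (by simp [Fin.forall_fin_two]) (by omega) (by simp [Fin.forall_fin_two])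
  -- Counter `0` is the input, counter `1` the candidate, and counter `2` a flag, initially `1`. The
  -- loop takes the flag down to `0` and then adds the value of `g` to it; as this value is at most
  -- `1`, the loop goes on exactly while `g` is nonzero.
  refine ⟨seq (inc 2) (loop 2 (seq Q (inc 1))), fun n => ?_⟩
  let st (k y : ℕ) : Store := update (update (update (fun _ => 0) 0 n) 1 k) 2 y
  have hbody : ∀ k, (seq Q (inc 1)).Exec (st k 0) (st (k + 1) (g k n)) := by
    intro k
    refine exec_seq.2 ⟨_, hQ _ fun j hj => ?_, exec_inc.2 ?_⟩
    · simp only [st, update_apply]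
      rw [if_neg (by omega), if_neg (by omega), if_neg (by omega)]
    · funext j
      simp only [st, update_apply, List.Vector.ofFn]
      split_ifs <;> first | omega | simp_all
  have hdec : ∀ k, update (st k 1) 2 0 = st k 0 := fun k => by simp [st]
  have hloop : (∃ s', (seq (inc 2) (loop 2 (seq Q (inc 1)))).Exec (update (fun _ => 0) 0 n) s') ↔
      ∃ s', (loop 2 (seq Q (inc 1))).Exec (st 0 1) s' := by
    have : update (update (fun _ => 0) 0 n) 2 ((update (fun _ => 0) 0 n : Store) 2 + 1) =
        st 0 1 := by
      funext j
      simp only [st, update_apply]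
      split_ifs <;> first | omega | simp_all
    simp only [exec_seq, exec_inc, exists_eq_left, this]
  rw [hloop]
  constructor
  · rintro ⟨s', h⟩
    refine exec_loop_induction (motive := fun s => ∀ k, s = st k 1 → ∃ k, g k n = 0) ?_ ?_ h 0 rfl
    · rintro h k rfl
      simp [st] at h
    · rintro s m s₁ hm hP _ ih k rfl
      obtain rfl : m = 0 := by simpa [st] using hm.symm
      rw [hdec] at hP
      obtain rfl := exec_deterministic _ hP (hbody k)
      rcases Nat.le_one_iff_eq_zero_or_eq_one.1 (hg1 k n) with h | h
      · exact ⟨k, h⟩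
      · exact ih (k + 1) (by rw [h])
  · rintro ⟨k, hk⟩
    -- Induction on the distance to a known zero; the search may stop at an earlier one.
    have key : ∀ j k, g (k + j) n = 0 → ∃ s', (loop 2 (seq Q (inc 1))).Exec (st k 1) s' := by
      intro j
      induction j with
      | zero =>
        intro k hk
        refine ⟨_, exec_loop_succ (n := 0) (by simp [st]) (by rw [hdec]; exact hbody k)
          (exec_loop_zero ?_)⟩
        simpa [st] using hk
      | succ j ih =>
        intro k hk
        rcases Nat.le_one_iff_eq_zero_or_eq_one.1 (hg1 k n) with h | h
        · refine ⟨_, exec_loop_succ (n := 0) (by simp [st]) (by rw [hdec]; exact hbody k)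
            (exec_loop_zero ?_)⟩
          simpa [st] using h
        · obtain ⟨s', hs'⟩ := ih (k + 1) (by rwa [show k + 1 + j = k + (j + 1) by omega])
          exact ⟨s', exec_loop_succ (n := 0) (by simp [st]) (by rw [hdec]; exact hbody k)
            (by rwa [h])⟩
    exact key k 0 (by simpa using hk)

end Prog

/-! ### Executability as a counting condition -/

/-- `c` is an instruction on a counter below `R`. -/
def IsInstr (R : ℕ) (c : ℕ × ℕ) : Prop := ∃ r < R, c = incL r ∨ c = decL r ∨ c = zeroL r

theorem IsInstr.mono {R R' : ℕ} {c : ℕ × ℕ} (h : IsInstr R c) (hR : R ≤ R') : IsInstr R' c := by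
  obtain ⟨r, hr, h⟩ := h
  exact ⟨r, hr.trans_le hR, h⟩

theorem Prog.isInstr_of_mem_traces (P : Prog) {w : List (ℕ × ℕ)} (hw : w ∈ P.traces.matches') :
    ∀ c ∈ w, IsInstr P.bound c := by
  induction P generalizing w with
  | skip =>
    obtain rfl : w = [] := hw
    simp
  | inc r =>
    obtain rfl : w = [incL r] := hw
    simpa [bound] using ⟨r, r.lt_succ_self, Or.inl rfl⟩
  | seq P Q ihP ihQ =>
    obtain ⟨u, hu, v, hv, rfl⟩ := hw
    intro c hc
    rcases List.mem_append.1 hc with h | h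
    · exact (ihQ hu c h).mono (le_max_right _ _)
    · exact (ihP hv c h).mono (le_max_left _ _)
  | loop r P ih =>
    obtain ⟨u, hu, v, hv, rfl⟩ := hw
    obtain rfl : u = [zeroL r] := hu
    obtain ⟨L, rfl, hL⟩ := hv
    have hr : r < (loop r P).bound := (Nat.lt_succ_self r).trans_le (le_max_left _ _)
    intro c hc
    rcases List.mem_append.1 hc with h | h
    · exact ⟨r, hr, Or.inr (Or.inr (by simpa using h))⟩
    · obtain ⟨y, hy, hcy⟩ := List.mem_flatten.1 h
      obtain ⟨p, hp, d, hd, rfl⟩ := hL y hy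
      obtain rfl : d = [decL r] := hd
      rcases List.mem_append.1 hcy with h | h
      · exact (ih hp c h).mono (le_max_right _ _)
      · exact ⟨r, hr, Or.inr (Or.inl (by simpa using h))⟩

theorem run_replicate (n : ℕ) :
    Run (fun _ => 0) (List.replicate n (incL 0)) (Function.update (fun _ => 0) 0 n) := by
  induction n with
  | zero => rw [Function.update_eq_self_iff.2 rfl]; exact .nil _
  | succ n ih => exact .cons ih (step_incL.2 (by simp))

theorem run_deterministic {s s₁ s₂ : Store} {w : List (ℕ × ℕ)} (h₁ : Run s w s₁)
    (h₂ : Run s w s₂) : s₁ = s₂ := by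
  induction w generalizing s₁ s₂ with
  | nil => rw [run_nil] at h₁ h₂; rw [h₁, h₂]
  | cons c w ih =>
    obtain ⟨t, h1, h2⟩ := run_cons.1 h₁
    obtain ⟨t', h1', h2'⟩ := run_cons.1 h₂
    obtain rfl := ih h1 h1'
    rcases h2 with ⟨r, rfl, rfl⟩ | ⟨r, n, rfl, h, rfl⟩ | ⟨r, rfl, h, rfl⟩
    · exact (step_incL.1 h2').symm
    · obtain ⟨n', hn', rfl⟩ := step_decL.1 h2'
      rw [show n = n' by omega]
    · exact (step_zeroL.1 h2').2.symm

/-- The runs of a program from the store with `n` in the counter `0`. -/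
theorem Prog.exists_exec_iff (P : Prog) (n : ℕ) :
    (∃ s', P.Exec (Function.update (fun _ => 0) 0 n) s') ↔
      ∃ w ∈ P.traces.matches', ∃ s', Run (fun _ => 0) (w ++ List.replicate n (incL 0)) s' := by
  constructor
  · rintro ⟨s', w, hw, h⟩
    exact ⟨w, hw, s', run_append.2 ⟨_, run_replicate n, h⟩⟩
  · rintro ⟨w, hw, s', h⟩
    obtain ⟨s₁, h1, h2⟩ := run_append.1 h
    obtain rfl := run_deterministic h1 (run_replicate n)
    exact ⟨s', w, hw, h2⟩

/-- The counting condition for an instruction sequence (latest first) to be executable from the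
zero store. -/
def Valid : List (ℕ × ℕ) → Prop
  | [] => True
  | c :: t => Valid t ∧ (∀ r, c = decL r → t.count (decL r) < t.count (incL r)) ∧
      ∀ r, c = zeroL r → t.count (incL r) = t.count (decL r)

/-- The second conjunct is the invariant that carries the induction: it turns tests on the store
into comparisons of counts. -/
theorem valid_of_run {w : List (ℕ × ℕ)} {s : Store} (h : Run (fun _ => 0) w s) :
    Valid w ∧ ∀ r, s r + w.count (decL r) = w.count (incL r) := by
  induction w generalizing s with
  | nil => rw [run_nil.1 h]; simp [Valid]
  | cons c w ih =>
    obtain ⟨t, h1, h2⟩ := run_cons.1 h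
    obtain ⟨hv, hc⟩ := ih h1
    rcases h2 with ⟨r, rfl, rfl⟩ | ⟨r, n, rfl, h, rfl⟩ | ⟨r, rfl, h, rfl⟩
    · refine ⟨⟨hv, by simp [incL_ne_decL], by simp [incL_ne_zeroL]⟩, fun r' => ?_⟩
      have := hc r'
      rw [List.count_cons_of_ne (incL_ne_decL _ _), List.count_cons]
      by_cases hr : r' = r
      · subst hr; simp; omega
      · simp [hr, incL_inj, Ne.symm hr]; omega
    · refine ⟨⟨hv, fun r' hr' => ?_, by simp [decL_ne_zeroL]⟩, fun r' => ?_⟩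
      · obtain rfl := decL_inj.1 hr'
        have := hc r; omega
      · have := hc r'
        rw [List.count_cons_of_ne (incL_ne_decL _ _).symm, List.count_cons]
        by_cases hr : r' = r
        · subst hr; simp; omega
        · simp [hr, decL_inj, Ne.symm hr]; omega
    · refine ⟨⟨hv, fun r' hr' => absurd hr'.symm (decL_ne_zeroL _ _), fun r' hr' => ?_⟩,
        fun r' => ?_⟩
      · obtain rfl := zeroL_inj.1 hr'
        have := hc r; omega
      · rw [List.count_cons_of_ne (incL_ne_zeroL _ _).symm,
          List.count_cons_of_ne (decL_ne_zeroL _ _).symm]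
        exact hc r'

theorem exists_run_of_valid {R : ℕ} {w : List (ℕ × ℕ)} (hw : ∀ c ∈ w, IsInstr R c)
    (h : Valid w) : ∃ s, Run (fun _ => 0) w s := by
  induction w with
  | nil => exact ⟨_, .nil _⟩
  | cons c w ih =>
    obtain ⟨hv, hd, hz⟩ := h
    obtain ⟨s, hs⟩ := ih (fun c hc => hw c (by simp [hc])) hv
    have hc := (valid_of_run hs).2
    obtain ⟨r, -, rfl | rfl | rfl⟩ := hw c (by simp)
    · exact ⟨_, .cons hs (step_incL.2 rfl)⟩
    · have h1 := hd r rfl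
      have h2 := hc r
      exact ⟨_, .cons hs (step_decL.2 ⟨s r - 1, by omega, rfl⟩)⟩
    · have h1 := hz r rfl
      have h2 := hc r
      exact ⟨_, .cons hs (step_zeroL.2 ⟨by omega, rfl⟩)⟩

/-! ### Matching increments and decrements by data values -/

section DataWords

variable {D : Type*}

/-- The condition imposed on an instruction `c` with datum `d` executed after those in `t`. -/
def DataCond (c : ℕ × ℕ) (d : D) (t : List ((ℕ × ℕ) × D)) : Prop :=
  (∀ r, c = incL r → (incL r, d) ∉ t) ∧
  (∀ r, c = decL r → (incL r, d) ∈ t ∧ (decL r, d) ∉ t) ∧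
  ∀ r, c = zeroL r → ∀ e, (incL r, e) ∈ t → (decL r, e) ∈ t

def DataValid : List ((ℕ × ℕ) × D) → Prop
  | [] => True
  | x :: t => DataValid t ∧ DataCond x.1 x.2 t

theorem DataValid.cond_of_append {u t : List ((ℕ × ℕ) × D)} {x : (ℕ × ℕ) × D}
    (h : DataValid (u ++ x :: t)) : DataCond x.1 x.2 t := by
  induction u with
  | nil => exact h.2
  | cons y u ih => exact ih h.1

/-- The data values carried by the letter `c`. -/
def dataOf (c : ℕ × ℕ) (W : List ((ℕ × ℕ) × D)) : List D :=
  (W.filter fun x => x.1 = c).map Prod.snd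

theorem mem_dataOf {c : ℕ × ℕ} {W : List ((ℕ × ℕ) × D)} {d : D} :
    d ∈ dataOf c W ↔ (c, d) ∈ W := by
  simp [dataOf]

theorem length_dataOf (c : ℕ × ℕ) (W : List ((ℕ × ℕ) × D)) :
    (dataOf c W).length = (W.map Prod.fst).count c := by
  rw [dataOf, List.length_map, ← List.countP_eq_length_filter, List.count, List.countP_map]
  congr 1 with x
  simp [Bool.beq_eq_decide_eq]

theorem dataOf_cons_self (c : ℕ × ℕ) (d : D) (W : List ((ℕ × ℕ) × D)) :
    dataOf c ((c, d) :: W) = d :: dataOf c W := by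
  simp [dataOf]

theorem dataOf_cons_ne {c c' : ℕ × ℕ} (h : c' ≠ c) (d : D) (W : List ((ℕ × ℕ) × D)) :
    dataOf c ((c', d) :: W) = dataOf c W := by
  simp [dataOf, h]

theorem DataValid.nodup {W : List ((ℕ × ℕ) × D)} (h : DataValid W) (r : ℕ) :
    (dataOf (incL r) W).Nodup ∧ (dataOf (decL r) W).Nodup := by
  induction W with
  | nil => simp [dataOf]
  | cons x W ih =>
    obtain ⟨hW, hi, hd, -⟩ := h
    obtain ⟨c, d⟩ := x
    obtain ⟨h1, h2⟩ := ih hW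
    constructor
    · by_cases hc : c = incL r
      · subst hc
        rw [dataOf_cons_self]
        exact List.nodup_cons.2 ⟨fun h => hi r rfl (mem_dataOf.1 h), h1⟩
      · rwa [dataOf_cons_ne hc]
    · by_cases hc : c = decL r
      · subst hc
        rw [dataOf_cons_self]
        exact List.nodup_cons.2 ⟨fun h => (hd r rfl).2 (mem_dataOf.1 h), h2⟩
      · rwa [dataOf_cons_ne hc]

theorem DataValid.inc_of_dec {W : List ((ℕ × ℕ) × D)} (h : DataValid W) {r : ℕ} {d : D}
    (hd : (decL r, d) ∈ W) : (incL r, d) ∈ W := by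
  induction W with
  | nil => simp at hd
  | cons x W ih =>
    rcases List.mem_cons.1 hd with rfl | hd
    · exact List.mem_cons_of_mem _ (h.2.2.1 r rfl).1
    · exact List.mem_cons_of_mem _ (ih h.1 hd)

/-- For each counter the decremented data form a duplicate-free list contained in the duplicate-free
list of incremented data. At a decrement, one more incremented datum is still unused, so the count
is strictly smaller; at a zero test the reverse inclusion gives equality. -/
theorem DataValid.valid {W : List ((ℕ × ℕ) × D)} (h : DataValid W) : Valid (W.map Prod.fst) := by
  induction W with
  | nil => trivial
  | cons x W ih =>
    obtain ⟨hW, -, hd, hz⟩ := h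
    obtain ⟨c, d⟩ := x
    have hsub : ∀ r, dataOf (decL r) W ⊆ dataOf (incL r) W := fun r d hd =>
      mem_dataOf.2 (hW.inc_of_dec (mem_dataOf.1 hd))
    refine ⟨ih hW, fun r hr => ?_, fun r hr => ?_⟩
    · obtain ⟨h1, h2⟩ := hd r hr
      rw [← length_dataOf, ← length_dataOf]
      have hnd : (d :: dataOf (decL r) W).Nodup :=
        List.nodup_cons.2 ⟨fun h => h2 (mem_dataOf.1 h), (hW.nodup r).2⟩
      exact (List.subperm_of_subset hnd
        (List.cons_subset.2 ⟨mem_dataOf.2 h1, hsub r⟩)).length_le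
    · rw [← length_dataOf, ← length_dataOf]
      refine le_antisymm (List.subperm_of_subset (hW.nodup r).1 fun e he => ?_).length_le
        (List.subperm_of_subset (hW.nodup r).2 (hsub r)).length_le
      exact mem_dataOf.2 (hz r hr e (mem_dataOf.1 he))

/-- Number the occurrences of every letter by data values. -/
def annotate (φ : ℕ ↪ D) : List (ℕ × ℕ) → List ((ℕ × ℕ) × D)
  | [] => []
  | c :: t => (c, φ (t.count c)) :: annotate φ t

theorem map_fst_annotate (φ : ℕ ↪ D) (w : List (ℕ × ℕ)) : (annotate φ w).map Prod.fst = w := by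
  induction w with
  | nil => rfl
  | cons c w ih => simp [annotate, ih]

theorem mem_annotate {φ : ℕ ↪ D} {w : List (ℕ × ℕ)} {c : ℕ × ℕ} {d : D} :
    (c, d) ∈ annotate φ w ↔ ∃ j < w.count c, φ j = d := by
  induction w with
  | nil => simp [annotate]
  | cons c' w ih =>
    rw [annotate, List.mem_cons, ih, List.count_cons]
    by_cases h : c' = c
    · subst h
      simp only [Prod.mk.injEq, true_and, beq_self_eq_true, if_true]
      constructor
      · rintro (rfl | ⟨j, hj, rfl⟩)
        · exact ⟨_, Nat.lt_succ_self _, rfl⟩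
        · exact ⟨j, by omega, rfl⟩
      · rintro ⟨j, hj, rfl⟩
        rcases Nat.lt_succ_iff_lt_or_eq.1 hj with h | rfl
        · exact Or.inr ⟨j, h, rfl⟩
        · exact Or.inl rfl
    · simp [h, Ne.symm h]

/-- The data carried by a letter are an initial segment of the numbering `φ`, the same numbering for
every letter. Comparing counts of increments and decrements is therefore comparing their sets of
data. -/
theorem Valid.dataValid_annotate (φ : ℕ ↪ D) {w : List (ℕ × ℕ)} (h : Valid w) :
    DataValid (annotate φ w) := by
  induction w with
  | nil => trivial
  | cons c w ih =>
    obtain ⟨hw, hd, hz⟩ := h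
    have hlast : (c, φ (w.count c)) ∉ annotate φ w := by
      rw [mem_annotate]
      rintro ⟨j, hj, h⟩
      exact hj.ne (φ.injective h)
    refine ⟨ih hw, ?_, ?_, ?_⟩
    · rintro r rfl
      exact hlast
    · rintro r rfl
      exact ⟨mem_annotate.2 ⟨_, hd r rfl, rfl⟩, hlast⟩
    · intro r hr e he
      rw [mem_annotate] at he ⊢
      rwa [← hz r hr]

end DataWords

end Counter

/-! ### Downward paths -/

namespace UTree

variable {E F : Type*} {T : UTree E}

theorem mem_of_prefix {p q : List ℕ} (h : p <+: q) (hq : q ∈ T.pos) : p ∈ T.pos := by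
  obtain ⟨r, rfl⟩ := h
  induction r using List.reverseRecOn with
  | nil => simpa using hq
  | append_singleton r i ih => exact ih (T.prefix_closed _ i (by simpa using hq))

theorem IsParent.prefix {x y : T.Node} (h : T.IsParent y x) : y.1 <+: x.1 := by
  obtain ⟨i, hi⟩ := h
  exact ⟨[i], hi.symm⟩

theorem IsParent.length {x y : T.Node} (h : T.IsParent y x) : x.1.length = y.1.length + 1 := by
  obtain ⟨i, hi⟩ := h
  simp [hi]

theorem IsParent.ne_root {x y : T.Node} (h : T.IsParent y x) : x ≠ T.root := by
  rintro rfl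
  simpa [root] using h.length

theorem exists_isParent {x : T.Node} (h : x ≠ T.root) : ∃ y, T.IsParent y x := by
  obtain ⟨p, hp⟩ := x
  rcases List.eq_nil_or_concat p with rfl | ⟨q, i, rfl⟩
  · exact absurd rfl h
  · exact ⟨⟨q, T.prefix_closed q i (by simpa using hp)⟩, i, by simp⟩

theorem root_prefix (x : T.Node) : T.root.1 <+: x.1 := List.nil_prefix

/-- Induction from the leaves to the root. -/
theorem leaf_induction {motive : T.Node → Prop} (leaf : ∀ x, T.IsLeaf x → motive x)
    (step : ∀ x z, T.IsParent x z → motive z → motive x) (x : T.Node) : motive x := by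
  have hb : ∀ y : T.Node, y.1.length ≤ T.pos.sup List.length := fun y =>
    Finset.le_sup (f := List.length) y.2
  induction hn : T.pos.sup List.length - x.1.length using Nat.strong_induction_on
    generalizing x with
  | _ n ih =>
    by_cases hx : T.IsLeaf x
    · exact leaf x hx
    · simp only [IsLeaf, not_forall, not_not] at hx
      obtain ⟨z, hz⟩ := hx
      have h1 := hb z
      have h2 := hz.length
      exact step x z hz (ih _ (by omega) z rfl)

namespace DownPath

theorem map {ℓ : T.Node → F} {G : Type*} (g : F → G) {x y : T.Node} {w : List F}
    (h : T.DownPath ℓ x w y) : T.DownPath (g ∘ ℓ) x (w.map g) y := by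
  induction h with
  | single x => exact .single x
  | step h _ ih => exact .step h ih

/-- With every node labelled by itself, the word of a path is its list of nodes, from which both the
positions and the original word can be read. -/
theorem exists_nodes {ℓ : T.Node → F} {x y : T.Node} {w : List F} (h : T.DownPath ℓ x w y) :
    ∃ L, T.DownPath id x L y ∧ L.map ℓ = w := by
  induction h with
  | single x => exact ⟨[x], .single x, rfl⟩
  | step h _ ih =>
    obtain ⟨L, hL, rfl⟩ := ih
    exact ⟨_, .step h hL, rfl⟩

variable {x y z : T.Node} {L M : List T.Node}

theorem length_eq (h : T.DownPath id x L y) : L.length + x.1.length = y.1.length + 1 := by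
  induction h with
  | single x => simp; omega
  | step h _ ih => have := h.length; simp; omega

theorem exists_cons (h : T.DownPath id x L y) : ∃ M, L = x :: M := by
  cases h with
  | single => exact ⟨[], rfl⟩
  | step => exact ⟨_, rfl⟩

theorem exists_append (h : T.DownPath id x L y) : ∃ M, L = M ++ [y] := by
  induction h with
  | single => exact ⟨[], rfl⟩
  | step _ _ ih =>
    obtain ⟨M, rfl⟩ := ih
    exact ⟨_ :: M, rfl⟩

theorem prefix_of_mem (h : T.DownPath id x L y) : ∀ u ∈ L, x.1 <+: u.1 := by
  induction h with
  | single => simp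
  | step h _ ih =>
    intro u hu
    rcases List.mem_cons.1 hu with rfl | hu
    · exact List.prefix_rfl
    · exact h.prefix.trans (ih u hu)

theorem prefix_end (h : T.DownPath id x L y) : x.1 <+: y.1 := by
  obtain ⟨M, rfl⟩ := h.exists_append
  exact h.prefix_of_mem y (by simp)

theorem of_append (h : T.DownPath id x (M ++ z :: L) y) : T.DownPath id z (z :: L) y := by
  induction M generalizing x with
  | nil =>
    obtain ⟨N, hN⟩ := h.exists_cons
    obtain rfl : z = x := (List.cons.inj hN).1
    exact h
  | cons u M ih =>
    generalize hw : u :: M ++ z :: L = w at h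
    cases h with
    | single => simp at hw
    | step h h' =>
      obtain ⟨-, rfl⟩ := List.cons.inj hw
      exact ih h'

theorem trans (h : T.DownPath id x L y) (h' : T.DownPath id y (y :: M) z) :
    T.DownPath id x (L ++ M) z := by
  induction h with
  | single => exact h'
  | step h _ ih => exact .step h (ih h')

theorem exists_of_prefix (h : x.1 <+: y.1) : ∃ L, T.DownPath id x L y := by
  obtain ⟨q, hq⟩ := y
  obtain ⟨r, hr⟩ := h
  simp only at hr
  subst hr
  induction r using List.reverseRecOn with
  | nil =>
    have : (⟨x.1 ++ [], hq⟩ : T.Node) = x := Subtype.ext (by simp)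
    rw [this]
    exact ⟨_, .single x⟩
  | append_singleton r i ih =>
    have hr : x.1 ++ r ∈ T.pos := T.prefix_closed _ i (by simpa using hq)
    obtain ⟨L, hL⟩ := ih hr
    refine ⟨_, hL.trans (.step (z := ⟨x.1 ++ (r ++ [i]), hq⟩) ⟨i, by simp⟩ (.single _))⟩

end DownPath

end UTree

/-! ### Regular expressions for paths -/

namespace Buda

open RegularExpression

/-- All letters. -/
def allLetters (k m : ℕ) : List (ℕ × ℕ) := List.range k ×ˢ List.range m

theorem mem_allLetters {k m : ℕ} {c : ℕ × ℕ} : c ∈ allLetters k m ↔ c.1 < k ∧ c.2 < m := by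
  obtain ⟨a, b⟩ := c
  simp [allLetters]

/-- The expression matching the one-letter words with letter in `S`. -/
def oneOf (S : List (ℕ × ℕ)) : Regex := S.foldr (fun c e => .plus (.char c) e) .zero

theorem mem_oneOf {S : List (ℕ × ℕ)} {w : List (ℕ × ℕ)} :
    w ∈ (oneOf S).matches' ↔ ∃ c ∈ S, w = [c] := by
  induction S with
  | nil =>
    simp only [List.not_mem_nil, false_and, exists_false, iff_false]
    exact fun h => h
  | cons c S ih =>
    change w ∈ (RegularExpression.char c + oneOf S).matches' ↔ _
    rw [matches'_add, Language.mem_add, ih]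
    simp only [List.mem_cons, exists_eq_or_imp]
    exact Iff.rfl

theorem mem_star_oneOf {S : List (ℕ × ℕ)} {w : List (ℕ × ℕ)} :
    w ∈ (oneOf S).star.matches' ↔ ∀ c ∈ w, c ∈ S := by
  rw [matches'_star, Language.mem_kstar]
  constructor
  · rintro ⟨L, rfl, hL⟩ c hc
    obtain ⟨y, hy, hcy⟩ := List.mem_flatten.1 hc
    obtain ⟨c', hc', rfl⟩ := mem_oneOf.1 (hL y hy)
    rwa [List.mem_singleton.1 hcy]
  · intro h
    have hw : (w.map fun c => [c]).flatten = w := by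
      clear h
      induction w with
      | nil => rfl
      | cons c w ih => rw [List.map_cons, List.flatten_cons, ih]; rfl
    refine ⟨w.map fun c => [c], hw.symm, fun y hy => ?_⟩
    obtain ⟨c, hc, rfl⟩ := List.mem_map.1 hy
    exact mem_oneOf.2 ⟨c, h c hc, rfl⟩

theorem inRange_oneOf {k m : ℕ} {S : List (ℕ × ℕ)} (h : ∀ c ∈ S, c.1 < k ∧ c.2 < m) :
    Regex.InRange k m (oneOf S) := by
  induction S with
  | nil => trivial
  | cons c S ih => exact ⟨h c (by simp), ih fun c hc => h c (by simp [hc])⟩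

/-- Words in which a letter `c` comes last and at least two letters precede it. -/
def deep (k m : ℕ) (c : ℕ × ℕ) : Regex :=
  oneOf (allLetters k m) * (oneOf (allLetters k m) * ((oneOf (allLetters k m)).star * .char c))

theorem mem_deep {k m : ℕ} {c : ℕ × ℕ} {w : List (ℕ × ℕ)} :
    w ∈ (deep k m c).matches' ↔
      ∃ u, w = u ++ [c] ∧ 2 ≤ u.length ∧ ∀ a ∈ u, a ∈ allLetters k m := by
  simp only [deep, matches'_mul, Language.mem_mul, mem_oneOf, mem_star_oneOf]
  constructor
  · rintro ⟨_, ⟨a, ha, rfl⟩, _, ⟨_, ⟨b, hb, rfl⟩, _, ⟨u, hu, v, hv, rfl⟩, rfl⟩, rfl⟩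
    obtain rfl : v = [c] := hv
    refine ⟨a :: b :: u, by simp, by simp, ?_⟩
    simpa [ha, hb] using fun a b h => hu (a, b) h
  · rintro ⟨u, rfl, hu, hall⟩
    match u, hu, hall with
    | a :: b :: u, _, hall =>
      exact ⟨[a], ⟨a, hall a (by simp), rfl⟩, b :: u ++ [c], ⟨[b], ⟨b, hall b (by simp), rfl⟩,
        u ++ [c], ⟨u, fun e he => hall e (by simp [he]), [c], rfl, rfl⟩, rfl⟩, rfl⟩

theorem inRange_deep {k m : ℕ} {c : ℕ × ℕ} (hc : c.1 < k ∧ c.2 < m) :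
    Regex.InRange k m (deep k m c) := by
  have h : Regex.InRange k m (oneOf (allLetters k m)) :=
    inRange_oneOf fun c hc => mem_allLetters.1 hc
  exact ⟨h, h, h, hc⟩

section

variable {k m : ℕ} {D : Type*} {T : DataTree k D} {β : T.Node → Fin m}

theorem fullLetter_mem (x : T.Node) : fullLetter T β x ∈ allLetters k m :=
  mem_allLetters.2 ⟨(T.letter x).2, (β x).2⟩

/-- The thread checking an instruction sits at the parent of its node, so the earlier instructions
begin two levels below the thread. -/
theorem holds_deep {c : ℕ × ℕ} {x : T.Node} {q : ℕ} {d : D} :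
    (BasicTest.pathEq (deep k m c)).Holds T β x q d ↔
      ∃ y : T.Node, x.1 <+: y.1 ∧ x.1.length + 2 ≤ y.1.length ∧ fullLetter T β y = c ∧
        T.datum y = d := by
  simp only [BasicTest.Holds, mem_deep]
  constructor
  · rintro ⟨w, y, hp, ⟨u, hu, hlen, -⟩, rfl⟩
    obtain ⟨L, hL, rfl⟩ := hp.exists_nodes
    have h1 := hL.length_eq
    have h2 := congrArg List.length hu
    simp only [List.length_map, List.length_append, List.length_singleton] at h2
    refine ⟨y, hL.prefix_end, by omega, ?_, rfl⟩
    obtain ⟨M, rfl⟩ := hL.exists_append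
    simp only [List.map_append, List.map_cons, List.map_nil] at hu
    simpa using (List.append_inj' hu rfl).2
  · rintro ⟨y, hxy, hlen, rfl, rfl⟩
    obtain ⟨L, hL⟩ := UTree.DownPath.exists_of_prefix hxy
    have h1 := hL.length_eq
    refine ⟨_, y, hL.map (fullLetter T β), ?_, rfl⟩
    obtain ⟨M, rfl⟩ := hL.exists_append
    refine ⟨M.map (fullLetter T β), by simp, ?_, ?_⟩
    · simp at h1 ⊢; omega
    · intro a ha
      obtain ⟨z, -, rfl⟩ := List.mem_map.1 ha
      exact fullLetter_mem z

end

end Buda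

/-- A node carries a thread in the initial state as soon as such threads are always kept. -/
theorem BUDA.IsRun.exists_init {D : Type*} {A : BUDA} {T : DataTree A.numLetters D}
    {β : T.Node → Fin A.numInternal} {ρ : T.Node → Set (ℕ × D)} (h : A.IsRun T β ρ)
    (hkeep : ∀ x d, x ≠ T.root → ∀ τ ∈ A.trans, (∀ l ∈ τ.1, l.Holds T β x A.init d) →
      .keep A.init ∈ τ.2) (x : T.Node) : ∃ e, (A.init, e) ∈ ρ x := by
  refine UTree.leaf_induction (motive := fun x => ∃ e, (A.init, e) ∈ ρ x) ?_ ?_ x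
  · intro x hx
    obtain ⟨e, he⟩ := h.leaf x hx
    exact ⟨e, by rw [he]; rfl⟩
  · rintro x z hxz ⟨e, he⟩
    obtain ⟨τ, hτ, hl, ha⟩ := h.step z x hxz _ _ he
    exact ⟨e, ha _ (hkeep z e hxz.ne_root τ hτ hl)⟩

/-! ### Unary trees -/

namespace UTree

variable {E : Type*} {T : UTree E}

/-- Every node has at most one child. -/
def Unary (T : UTree E) : Prop := ∀ x i, x ++ [i] ∈ T.pos → i = 0

theorem IsParent.prefix_of_unary (hT : T.Unary) {x z u : T.Node} (hz : T.IsParent x z)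
    (hxu : x.1 <+: u.1) (hne : u ≠ x) : z.1 <+: u.1 := by
  obtain ⟨r, hr⟩ := hxu
  obtain ⟨j, hj⟩ := hz
  cases r with
  | nil => exact absurd (Subtype.ext (by simpa using hr.symm)) hne
  | cons i r =>
    have h1 : x.1 ++ [i] ∈ T.pos := mem_of_prefix ⟨r, by simpa using hr⟩ u.2
    have h2 : x.1 ++ [j] ∈ T.pos := hj ▸ z.2
    rw [hT _ _ h2] at hj
    rw [hT _ _ h1] at hr
    exact ⟨r, by rw [hj, ← hr]; simp⟩

theorem IsLeaf.eq_of_prefix {x u : T.Node} (hx : T.IsLeaf x) (h : x.1 <+: u.1) : u = x := by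
  obtain ⟨r, hr⟩ := h
  cases r with
  | nil => exact Subtype.ext (by simpa using hr.symm)
  | cons i r =>
    have h1 : x.1 ++ [i] ∈ T.pos := mem_of_prefix ⟨r, by simpa using hr⟩ u.2
    exact absurd ⟨i, rfl⟩ (hx ⟨_, h1⟩)

theorem Unary.prefix_or_prefix (hT : T.Unary) (x y : T.Node) : x.1 <+: y.1 ∨ y.1 <+: x.1 := by
  have h : ∀ p ∈ T.pos, p = List.replicate p.length 0 := by
    intro p
    induction p using List.reverseRecOn with
    | nil => simp
    | append_singleton p i ih =>
      intro hp
      obtain rfl := hT _ _ hp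
      rw [List.length_append, List.length_singleton, List.replicate_succ',
        ← ih (T.prefix_closed _ _ hp)]
  rw [h _ x.2, h _ y.2]
  rcases le_total x.1.length y.1.length with h | h
  · left
    exact ⟨List.replicate (y.1.length - x.1.length) 0, by
      rw [← List.replicate_add, Nat.add_sub_cancel' h]⟩
  · right
    exact ⟨List.replicate (x.1.length - y.1.length) 0, by
      rw [← List.replicate_add, Nat.add_sub_cancel' h]⟩

/-- In a unary tree a path to a leaf exhausts the subtree of its start. This is why existential path
tests speak about a single word there. -/
theorem DownPath.mem_of_unary (hT : T.Unary) {x y u : T.Node} {L : List T.Node}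
    (h : T.DownPath id x L y) (hy : T.IsLeaf y) (hu : x.1 <+: u.1) : u ∈ L := by
  induction h with
  | single x => simp [hy.eq_of_prefix hu]
  | @step x z y w h _ ih =>
    by_cases hux : u = x
    · exact hux ▸ List.mem_cons_self
    · exact List.mem_cons_of_mem _ (ih hy (h.prefix_of_unary hT hu hux))

/-- The unary tree whose nodes are labelled by the entries of a list, from the root down. -/
def ofList (L : List E) (hL : L ≠ []) : UTree E where
  pos := (Finset.range L.length).image fun i => List.replicate i 0
  root_mem := Finset.mem_image.2 ⟨0, by simpa using List.length_pos_iff.2 hL, rfl⟩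
  prefix_closed x i h := by
    obtain ⟨n, hn, h⟩ := Finset.mem_image.1 h
    have hlen := congrArg List.length h
    simp only [List.length_replicate, List.length_append, List.length_singleton] at hlen
    subst hlen
    rw [List.replicate_succ'] at h
    exact Finset.mem_image.2 ⟨_, by simp at hn ⊢; omega, (List.append_inj' h rfl).1⟩
  sibling_closed x i h := by
    obtain ⟨n, hn, h⟩ := Finset.mem_image.1 h
    have : i + 1 = 0 := List.eq_of_mem_replicate (n := n) (a := 0) (by rw [h]; simp)
    omega
  label x := L[x.1.length]'(by
    obtain ⟨n, hn, h⟩ := Finset.mem_image.1 x.2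
    rw [← h]
    simpa using hn)

variable {L : List E} {hL : L ≠ []}

theorem mem_ofList {p : List ℕ} :
    p ∈ (ofList L hL).pos ↔ p.length < L.length ∧ p = List.replicate p.length 0 := by
  change p ∈ Finset.image _ _ ↔ _
  rw [Finset.mem_image]
  constructor
  · rintro ⟨n, hn, rfl⟩
    simpa using hn
  · rintro ⟨h, h'⟩
    exact ⟨p.length, by simpa using h, h'.symm⟩

theorem unary_ofList : (ofList L hL).Unary := fun x i h =>
  List.eq_of_mem_replicate (n := (x ++ [i]).length) (a := 0) (by
    rw [← (mem_ofList.1 h).2]; simp)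

/-- The node of a given depth. -/
def ofListNode (L : List E) (hL : L ≠ []) (i : ℕ) (hi : i < L.length) : (ofList L hL).Node :=
  ⟨List.replicate i 0, mem_ofList.2 (by simpa using hi)⟩

theorem ofList_prefix_iff {x y : (ofList L hL).Node} :
    x.1 <+: y.1 ↔ x.1.length ≤ y.1.length := by
  refine ⟨List.IsPrefix.length_le, fun h => ?_⟩
  rcases unary_ofList.prefix_or_prefix x y with h' | h'
  · exact h'
  · rw [h'.eq_of_length_le h]

theorem ofList_isLeaf_iff {x : (ofList L hL).Node} :
    (ofList L hL).IsLeaf x ↔ x.1.length + 1 = L.length := by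
  have hx := mem_ofList.1 x.2
  constructor
  · intro h
    by_contra hne
    refine h (ofListNode L hL (x.1.length + 1) (by omega)) ⟨0, ?_⟩
    change List.replicate (x.1.length + 1) 0 = x.1 ++ [0]
    rw [List.replicate_succ', ← hx.2]
  · intro h y hy
    have h1 := hy.length
    have h2 := (mem_ofList.1 y.2).1
    omega

theorem downPath_ofList {F : Type*} (g : E → F) (x : (ofList L hL).Node) :
    ∃ y, y.1.length + 1 = L.length ∧
      (ofList L hL).DownPath (g ∘ (ofList L hL).label) x ((L.drop x.1.length).map g) y := by
  have hd : ∀ x : (ofList L hL).Node, L.drop x.1.length =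
      (ofList L hL).label x :: L.drop (x.1.length + 1) := fun x =>
    List.drop_eq_getElem_cons (mem_ofList.1 x.2).1
  refine leaf_induction (motive := fun x => ∃ y, y.1.length + 1 = L.length ∧
      (ofList L hL).DownPath (g ∘ (ofList L hL).label) x ((L.drop x.1.length).map g) y) ?_ ?_ x
  · intro x hx
    rw [ofList_isLeaf_iff] at hx
    refine ⟨x, hx, ?_⟩
    rw [hd, List.drop_eq_nil_of_le hx.ge]
    exact .single x
  · rintro x z hxz ⟨y, hy, h⟩
    refine ⟨y, hy, ?_⟩
    rw [hd, ← hxz.length]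
    exact .step hxz h

end UTree

/-! ### The automaton checking the traces of counter programs -/

namespace Counter

open Buda

/-- Threads in state `0` walk to the root; a thread in another state, named after a letter, checks
the condition for an instruction with this letter at the child. -/
def checks (R : ℕ) : List Transition :=
  ([.pos (.state 0), .pos (.letter 0), .pos .leaf], [.keep 0]) ::
  (List.range R).flatMap fun r => [
    ([.pos (.state 0), .pos (.letter (3 * r + 1))], [.keep 0, .store (3 * r + 1)]),
    ([.pos (.state 0), .pos (.letter (3 * r + 2))], [.keep 0, .store (3 * r + 2)]),
    ([.pos (.state 0), .pos (.letter (3 * r + 3))], [.keep 0, .univ (3 * r + 3)]),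
    ([.pos (.state (3 * r + 1)), .neg (.pathEq (deep (3 * R + 1) 1 (incL r)))], [.accept]),
    ([.pos (.state (3 * r + 2)), .pos (.pathEq (deep (3 * R + 1) 1 (incL r))),
      .neg (.pathEq (deep (3 * R + 1) 1 (decL r)))], [.accept]),
    ([.pos (.state (3 * r + 3)), .neg (.pathEq (deep (3 * R + 1) 1 (incL r)))], [.accept]),
    ([.pos (.state (3 * r + 3)), .pos (.pathEq (deep (3 * R + 1) 1 (decL r)))], [.accept])]

def rootCheck (e : Regex) : Transition :=
  ([.pos (.state 0), .pos .root, .pos (.pathEq e)], [.accept])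

/-- On unary trees, the automaton accepts the executable instruction sequences that match `e`. -/
def automaton (R : ℕ) (e : Regex) : BUDA := ⟨3 * R + 1, 1, 3 * R + 1, 0, rootCheck e :: checks R⟩

theorem automaton_wellFormed {R : ℕ} {e : Regex} (he : Regex.InRange (3 * R + 1) 1 e) :
    (automaton R e).WellFormed := by
  have hr : ∀ r < R, (3 * r + 1 < 3 * R + 1 ∧ 3 * r + 2 < 3 * R + 1 ∧ 3 * r + 3 < 3 * R + 1) ∧
      Regex.InRange (3 * R + 1) 1 (deep (3 * R + 1) 1 (incL r)) ∧
      Regex.InRange (3 * R + 1) 1 (deep (3 * R + 1) 1 (decL r)) := fun r hr =>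
    ⟨by omega, inRange_deep (by simp [incL]; omega), inRange_deep (by simp [decL]; omega)⟩
  constructor
  · simp [automaton]
  · intro τ hτ l hl
    simp only [automaton, checks, rootCheck, List.mem_cons, List.mem_flatMap, List.mem_range,
      List.not_mem_nil, or_false] at hτ
    rcases hτ with rfl | rfl | ⟨r, hrR, h⟩
    · simp only [List.mem_cons, List.not_mem_nil, or_false] at hl
      rcases hl with rfl | rfl | rfl <;>
        simp [Literal.InRange, BasicTest.InRange, automaton, he]
    · simp only [List.mem_cons, List.not_mem_nil, or_false] at hl
      rcases hl with rfl | rfl | rfl <;> simp [Literal.InRange, BasicTest.InRange, automaton]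
    · obtain ⟨⟨h1, h2, h3⟩, h4, h5⟩ := hr r hrR
      rcases h with rfl | rfl | rfl | rfl | rfl | rfl | rfl <;>
        simp only [List.mem_cons, List.not_mem_nil, or_false] at hl <;>
        rcases hl with rfl | rfl | rfl <;>
        first
        | exact h1
        | exact h2
        | exact h3
        | exact h4
        | exact h5
        | exact Nat.succ_pos _
  · intro τ hτ a ha
    simp only [automaton, checks, rootCheck, List.mem_cons, List.mem_flatMap, List.mem_range,
      List.not_mem_nil, or_false] at hτ
    rcases hτ with rfl | rfl | ⟨r, hrR, h⟩
    · simp only [List.mem_cons, List.not_mem_nil, or_false] at ha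
      subst ha; trivial
    · simp only [List.mem_cons, List.not_mem_nil, or_false] at ha
      subst ha; exact Nat.succ_pos _
    · obtain ⟨⟨h1, h2, h3⟩, -⟩ := hr r hrR
      rcases h with rfl | rfl | rfl | rfl | rfl | rfl | rfl <;>
        simp only [List.mem_cons, List.not_mem_nil, or_false] at ha <;>
        rcases ha with rfl | rfl <;>
        first
        | exact h1
        | exact h2
        | exact h3
        | exact Nat.succ_pos _
        | trivial
  · intro τ hτ
    simp only [automaton, checks, rootCheck, List.mem_cons, List.mem_flatMap, List.mem_range,
      List.not_mem_nil, or_false] at hτ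
    rcases hτ with rfl | rfl | ⟨r, hrR, rfl | rfl | rfl | rfl | rfl | rfl | rfl⟩ <;> simp

variable {D : Type*} {R : ℕ} {e : Regex}

/-! ### From accepting runs on unary trees to executable traces -/

section Soundness

variable {T : DataTree (3 * R + 1) D} {β : T.Node → Fin 1} {ρ : T.Node → Set (ℕ × D)}

theorem exists_trans_of_mem (hρ : (automaton R e).IsRun T β ρ)
    (hacc : (automaton R e).IsAccepting T β ρ) {x : T.Node} {q : ℕ} {d : D} (h : (q, d) ∈ ρ x) :
    ∃ τ ∈ rootCheck e :: checks R, ∀ l ∈ τ.1, l.Holds T β x q d := by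
  by_cases hx : x = T.root
  · subst hx
    obtain ⟨τ, hτ, hl, -⟩ := hacc q d h
    exact ⟨τ, hτ, hl⟩
  · obtain ⟨y, hy⟩ := UTree.exists_isParent hx
    obtain ⟨τ, hτ, hl, -⟩ := hρ.step x y hy q d h
    exact ⟨τ, hτ, hl⟩

/-- The only transition for state `0` without `keep 0` is `rootCheck`, which is not available below
the root. -/
theorem exists_walker (hρ : (automaton R e).IsRun T β ρ) (x : T.Node) : ∃ d, (0, d) ∈ ρ x := by
  refine hρ.exists_init ?_ x
  intro x d hx τ hτ hl
  simp only [automaton, checks, rootCheck, List.mem_cons, List.mem_flatMap, List.mem_range,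
    List.not_mem_nil, or_false] at hτ hl
  rcases hτ with rfl | rfl | ⟨r, hrR, rfl | rfl | rfl | rfl | rfl | rfl | rfl⟩ <;>
    simp_all [Literal.Holds, BasicTest.Holds, automaton]

theorem fullLetter_eq {x : T.Node} {a : ℕ} (h : (T.letter x : ℕ) = a) :
    fullLetter T β x = (a, 0) :=
  Prod.ext h (Nat.lt_one_iff.1 (β x).2)

/-- The walker cannot be stopped, so it must find a transition at each node below the root: an
instruction forces its checks onto the parent, and the marker is tolerated only at a leaf. -/
theorem walker_step (hρ : (automaton R e).IsRun T β ρ) {x y : T.Node} (hxy : T.IsParent y x) :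
    (fullLetter T β x = (0, 0) ∧ T.IsLeaf x) ∨ ∃ r < R,
      (fullLetter T β x = incL r ∧ (3 * r + 1, T.datum x) ∈ ρ y) ∨
      (fullLetter T β x = decL r ∧ (3 * r + 2, T.datum x) ∈ ρ y) ∨
      (fullLetter T β x = zeroL r ∧ ∀ d ∈ T.dataBelow x, (3 * r + 3, d) ∈ ρ y) := by
  obtain ⟨d, hd⟩ := exists_walker hρ x
  obtain ⟨τ, hτ, hl, ha⟩ := hρ.step x y hxy _ _ hd
  have hx := hxy.ne_root
  simp only [automaton, checks, rootCheck, List.mem_cons, List.mem_flatMap, List.mem_range,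
    List.not_mem_nil, or_false] at hτ
  rcases hτ with rfl | rfl | ⟨r, hrR, rfl | rfl | rfl | rfl | rfl | rfl | rfl⟩ <;>
    simp [Literal.Holds, BasicTest.Holds, BasicAction.Realized] at hl ha
  · exact absurd hl.1 hx
  · exact Or.inl ⟨fullLetter_eq hl.1, hl.2⟩
  · exact Or.inr ⟨r, hrR, Or.inl ⟨fullLetter_eq hl, ha.2⟩⟩
  · exact Or.inr ⟨r, hrR, Or.inr (Or.inl ⟨fullLetter_eq hl, ha.2⟩)⟩
  · exact Or.inr ⟨r, hrR, Or.inr (Or.inr ⟨fullLetter_eq hl, ha.2⟩)⟩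

/-- A checking state admits only the transitions written for it, as the numbering modulo 3 shows;
the same argument serves the two other kinds of checking thread. -/
theorem inc_thread (hρ : (automaton R e).IsRun T β ρ)
    (hacc : (automaton R e).IsAccepting T β ρ) {x : T.Node} {r : ℕ} {d : D}
    (h : (3 * r + 1, d) ∈ ρ x) :
    ¬ (BasicTest.pathEq (deep (3 * R + 1) 1 (incL r))).Holds T β x (3 * r + 1) d := by
  obtain ⟨τ, hτ, hl⟩ := exists_trans_of_mem hρ hacc h
  simp only [checks, rootCheck, List.mem_cons, List.mem_flatMap, List.mem_range,
    List.not_mem_nil, or_false] at hτ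
  rcases hτ with rfl | rfl | ⟨r', hrR, rfl | rfl | rfl | rfl | rfl | rfl | rfl⟩ <;>
    simp only [List.mem_cons, List.not_mem_nil, or_false, forall_eq_or_imp, forall_eq] at hl <;>
    obtain ⟨hq, hl⟩ := hl <;> change 3 * r + 1 = _ at hq
  all_goals first | omega | obtain rfl : r = r' := by omega
  exact hl

theorem dec_thread (hρ : (automaton R e).IsRun T β ρ)
    (hacc : (automaton R e).IsAccepting T β ρ) {x : T.Node} {r : ℕ} {d : D}
    (h : (3 * r + 2, d) ∈ ρ x) :
    (BasicTest.pathEq (deep (3 * R + 1) 1 (incL r))).Holds T β x (3 * r + 2) d ∧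
    ¬ (BasicTest.pathEq (deep (3 * R + 1) 1 (decL r))).Holds T β x (3 * r + 2) d := by
  obtain ⟨τ, hτ, hl⟩ := exists_trans_of_mem hρ hacc h
  simp only [checks, rootCheck, List.mem_cons, List.mem_flatMap, List.mem_range,
    List.not_mem_nil, or_false] at hτ
  rcases hτ with rfl | rfl | ⟨r', hrR, rfl | rfl | rfl | rfl | rfl | rfl | rfl⟩ <;>
    simp only [List.mem_cons, List.not_mem_nil, or_false, forall_eq_or_imp, forall_eq] at hl <;>
    obtain ⟨hq, hl⟩ := hl <;> change 3 * r + 2 = _ at hq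
  all_goals first | omega | obtain rfl : r = r' := by omega
  exact hl

theorem zero_thread (hρ : (automaton R e).IsRun T β ρ)
    (hacc : (automaton R e).IsAccepting T β ρ) {x : T.Node} {r : ℕ} {d : D}
    (h : (3 * r + 3, d) ∈ ρ x)
    (hi : (BasicTest.pathEq (deep (3 * R + 1) 1 (incL r))).Holds T β x (3 * r + 3) d) :
    (BasicTest.pathEq (deep (3 * R + 1) 1 (decL r))).Holds T β x (3 * r + 3) d := by
  obtain ⟨τ, hτ, hl⟩ := exists_trans_of_mem hρ hacc h
  simp only [checks, rootCheck, List.mem_cons, List.mem_flatMap, List.mem_range,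
    List.not_mem_nil, or_false] at hτ
  rcases hτ with rfl | rfl | ⟨r', hrR, rfl | rfl | rfl | rfl | rfl | rfl | rfl⟩ <;>
    simp only [List.mem_cons, List.not_mem_nil, or_false, forall_eq_or_imp, forall_eq] at hl <;>
    obtain ⟨hq, hl⟩ := hl <;> change 3 * r + 3 = _ at hq
  all_goals first | omega | obtain rfl : r = r' := by omega
  · exact absurd hi hl
  · exact hl

/-- The letter and the datum at a node. -/
def entry (T : DataTree (3 * R + 1) D) (β : T.Node → Fin 1) (x : T.Node) : (ℕ × ℕ) × D :=
  (fullLetter T β x, T.datum x)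

/-- The condition at `z` is verified by threads at its parent `x`, and unarity identifies what they
see with the part of the path after `z`. The head of the path is left out because its check would
belong to its own parent, which the root does not have. -/
theorem dataValid_of_downPath (hρ : (automaton R e).IsRun T β ρ)
    (hacc : (automaton R e).IsAccepting T β ρ) (hT : T.Unary) {x y : T.Node} {L : List T.Node}
    (h : T.DownPath id x L y) (hy : T.IsLeaf y) : DataValid (L.tail.map (entry T β)) := by
  induction h with
  | single => trivial
  | @step x z y L hxz hp ih =>
    obtain ⟨M, rfl⟩ := hp.exists_cons
    refine ⟨ih hy, ?_⟩
    have hmem : ∀ {q c d}, (BasicTest.pathEq (deep (3 * R + 1) 1 c)).Holds T β x q d ↔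
        (c, d) ∈ M.map (entry T β) := by
      intro q c d
      rw [holds_deep, List.mem_map]
      have hlen := hxz.length
      constructor
      · rintro ⟨u, hxu, hl, rfl, rfl⟩
        have := (UTree.DownPath.step hxz hp).mem_of_unary hT hy hxu
        refine ⟨u, ?_, rfl⟩
        rcases List.mem_cons.1 this with h | h
        · change u = x at h
          subst h; omega
        · rcases List.mem_cons.1 h with rfl | h
          · omega
          · exact h
      · rintro ⟨u, hu, huc⟩
        obtain ⟨rfl, rfl⟩ := Prod.mk.inj huc
        obtain ⟨M₁, M₂, rfl⟩ := List.append_of_mem hu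
        refine ⟨u, hxz.prefix.trans (hp.prefix_of_mem u (by simp)), ?_, rfl, rfl⟩
        have h1 := (hp.of_append (M := z :: M₁)).length_eq
        have h2 := hp.length_eq
        simp at h1 h2
        omega
    -- All data of the past occur below `z`, so `univ` at a zero test spawns a thread for each of
    -- them.
    have hbelow : ∀ c d, (c, d) ∈ M.map (entry T β) → d ∈ T.dataBelow z := by
      intro c d h
      obtain ⟨u, hu, huc⟩ := List.mem_map.1 h
      exact ⟨u, hp.prefix_of_mem u (by simp [hu]), (Prod.mk.inj huc).2⟩
    rcases walker_step hρ hxz with ⟨hz, -⟩ | ⟨r, -, ⟨hz, h⟩ | ⟨hz, h⟩ | ⟨hz, h⟩⟩ <;>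
      simp only [entry, hz, DataCond]
    · simp [incL, decL, zeroL]
    · refine ⟨fun r' hr' => ?_, by simp [incL_ne_decL], by simp [incL_ne_zeroL]⟩
      obtain rfl := incL_inj.1 hr'
      exact fun hm => inc_thread hρ hacc h (hmem.2 hm)
    · refine ⟨fun r' hr' => absurd hr'.symm (incL_ne_decL _ _), fun r' hr' => ?_,
        by simp [decL_ne_zeroL]⟩
      obtain rfl := decL_inj.1 hr'
      obtain ⟨h1, h2⟩ := dec_thread hρ hacc h
      exact ⟨hmem.1 h1, fun hm => h2 (hmem.2 hm)⟩
    · refine ⟨fun r' hr' => absurd hr'.symm (incL_ne_zeroL _ _),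
        fun r' hr' => absurd hr'.symm (decL_ne_zeroL _ _), fun r' hr' d hd => ?_⟩
      obtain rfl := zeroL_inj.1 hr'
      exact hmem.1 (zero_thread hρ hacc (h d (hbelow _ _ hd)) (hmem.2 hd))

/-- The path found by the root check ends in a marker below the root, hence at a leaf. It thus
covers the whole unary tree, and every instruction on it has been checked against its entire past.
-/
theorem exists_valid_of_isRun (he : ∀ w ∈ e.matches', ∃ u, w = (0, 0) :: (u ++ [(0, 0)]))
    (hT : T.Unary) (hρ : (automaton R e).IsRun T β ρ)
    (hacc : (automaton R e).IsAccepting T β ρ) :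
    ∃ u, (0, 0) :: (u ++ [(0, 0)]) ∈ e.matches' ∧ Valid (u ++ [(0, 0)]) := by
  obtain ⟨d, hd⟩ := exists_walker hρ T.root
  obtain ⟨τ, hτ, hl, ha⟩ := hacc _ _ hd
  simp only [automaton, checks, rootCheck, List.mem_cons, List.mem_flatMap, List.mem_range,
    List.not_mem_nil, or_false] at hτ
  rcases hτ with rfl | rfl | ⟨r, hrR, rfl | rfl | rfl | rfl | rfl | rfl | rfl⟩
  · have hroot : (BasicTest.pathEq e).Holds T β T.root 0 d :=
      hl (.pos (.pathEq e)) (by simp)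
    obtain ⟨w, y, hp, hw, -⟩ := hroot
    obtain ⟨u, rfl⟩ := he w hw
    obtain ⟨L, hL, hLw⟩ := hp.exists_nodes
    refine ⟨u, hw, ?_⟩
    have hlen := congrArg List.length hLw
    have hlen' := hL.length_eq
    have hy : y ≠ T.root := by
      rintro rfl
      simp at hlen
      omega
    obtain ⟨M, rfl⟩ := hL.exists_append
    have hlast : fullLetter T β y = (0, 0) := by
      rw [List.map_append, ← List.cons_append] at hLw
      simpa using (List.append_inj' hLw rfl).2
    obtain ⟨x, hx⟩ := UTree.exists_isParent hy
    have hleaf : T.IsLeaf y := by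
      rcases walker_step hρ hx with ⟨-, h⟩ | ⟨r, -, ⟨h, -⟩ | ⟨h, -⟩ | ⟨h, -⟩⟩
      · exact h
      all_goals simp [hlast, incL, decL, zeroL] at h
    have hv := (dataValid_of_downPath hρ hacc hT hL hleaf).valid
    have : ((M ++ [y]).tail.map (entry T β)).map Prod.fst = u ++ [(0, 0)] := by
      rw [List.map_map, List.map_tail]
      change ((M ++ [y]).map (fullLetter T β)).tail = _
      rw [hLw, List.tail_cons]
    rwa [this] at hv
  -- Every other transition either does more than accept or belongs to a nonzero state.
  all_goals first
    | (simp at ha; done)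
    | (have h0 : 0 = _ := hl _ List.mem_cons_self; omega)

theorem exists_valid_of_accepts (he : ∀ w ∈ e.matches', ∃ u, w = (0, 0) :: (u ++ [(0, 0)]))
    (hT : T.Unary) (h : (automaton R e).Accepts T) :
    ∃ u, (0, 0) :: (u ++ [(0, 0)]) ∈ e.matches' ∧ Valid (u ++ [(0, 0)]) := by
  obtain ⟨β, ρ, hρ, hacc⟩ := h
  exact exists_valid_of_isRun he hT hρ hacc

end Soundness

/-! ### From executable traces to accepting runs on unary trees -/

section Completeness

variable {T : DataTree (3 * R + 1) D} {β : T.Node → Fin 1}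

/-- The letter `c` with datum `d` occurs at least two levels below `x`. -/
def OccursBelow (T : DataTree (3 * R + 1) D) (β : T.Node → Fin 1) (x : T.Node) (c : ℕ × ℕ)
    (d : D) : Prop :=
  ∃ y : T.Node, x.1 <+: y.1 ∧ x.1.length + 2 ≤ y.1.length ∧ fullLetter T β y = c ∧ T.datum y = d

/-- The condition on data values, stated for the child `z` of `x`. -/
def NodeCond (T : DataTree (3 * R + 1) D) (β : T.Node → Fin 1) (x z : T.Node) : Prop :=
  (∀ r, fullLetter T β z = incL r → ¬ OccursBelow T β x (incL r) (T.datum z)) ∧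
  (∀ r, fullLetter T β z = decL r →
    OccursBelow T β x (incL r) (T.datum z) ∧ ¬ OccursBelow T β x (decL r) (T.datum z)) ∧
  ∀ r, fullLetter T β z = zeroL r → ∀ d, OccursBelow T β x (incL r) d → OccursBelow T β x (decL r) d

/-- The threads of the accepting run: a walker, and one checking thread for the child, or one for
each datum below the child if this is a zero test. -/
def threads (T : DataTree (3 * R + 1) D) (d₀ : D) (x : T.Node) : Set (ℕ × D) :=
  {θ | θ = (0, d₀) ∨ ∃ z, T.IsParent x z ∧ θ.1 = T.letter z ∧ θ.1 ≠ 0 ∧ θ.2 ∈ T.dataBelow z ∧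
    (θ.1 % 3 ≠ 0 → θ.2 = T.datum z)}

theorem self_mem_dataBelow (x : T.Node) : T.datum x ∈ T.dataBelow x := ⟨x, List.prefix_rfl, rfl⟩

theorem finite_threads (d₀ : D) (x : T.Node) : (threads T d₀ x).Finite := by
  refine Set.Finite.subset (((Set.finite_Iio (3 * R + 1)).prod (Set.finite_range T.datum)).union
    (Set.finite_singleton (0, d₀))) ?_
  rintro ⟨q, d⟩ (h | ⟨z, -, hq, -, ⟨y, -, hy⟩, -⟩)
  · exact Or.inr h
  · exact Or.inl ⟨by simp only at hq; subst hq; exact (T.letter z).2, y, hy⟩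

theorem checks_of_nodeCond {d₀ : D}
    (h1 : ∀ x, x ≠ T.root → (fullLetter T β x = (0, 0) ∧ T.IsLeaf x) ∨ IsInstr R (fullLetter T β x))
    (h2 : ∀ x z, T.IsParent x z → NodeCond T β x z) {x : T.Node} {q : ℕ} {d : D}
    (h : (q, d) ∈ threads T d₀ x) (hq : q ≠ 0) :
    ∃ τ ∈ checks R, (∀ l ∈ τ.1, l.Holds T β x q d) ∧ τ.2 = [.accept] := by
  rcases h with h | ⟨z, hz, hqz, -, -, hd⟩
  · exact absurd (Prod.mk.inj h).1 hq
  simp only at hqz hd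
  have hfst : (fullLetter T β z).1 = q := hqz.symm
  obtain ⟨hi, hdec, hzero⟩ := h2 x z hz
  have mem : ∀ r < R, ∀ τ, τ ∈ _ → τ ∈ checks R := fun r hr τ hτ =>
    List.mem_cons_of_mem _ (List.mem_flatMap.2 ⟨r, List.mem_range.2 hr, hτ⟩)
  rcases h1 z hz.ne_root with ⟨h0, -⟩ | ⟨r, hr, h | h | h⟩
  · rw [h0] at hfst
    exact absurd hfst.symm hq
  · rw [h] at hfst
    obtain rfl : 3 * r + 1 = q := hfst
    obtain rfl := hd (by omega)
    refine ⟨_, mem r hr ([.pos (.state (3 * r + 1)),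
      .neg (.pathEq (deep (3 * R + 1) 1 (incL r)))], [.accept]) (by simp), ?_, rfl⟩
    simp only [List.mem_cons, List.not_mem_nil, or_false, forall_eq_or_imp, forall_eq]
    exact ⟨rfl, fun hp => hi r h (holds_deep.1 hp)⟩
  · rw [h] at hfst
    obtain rfl : 3 * r + 2 = q := hfst
    obtain rfl := hd (by omega)
    obtain ⟨h3, h4⟩ := hdec r h
    refine ⟨_, mem r hr ([.pos (.state (3 * r + 2)), .pos (.pathEq (deep (3 * R + 1) 1 (incL r))),
      .neg (.pathEq (deep (3 * R + 1) 1 (decL r)))], [.accept]) (by simp), ?_, rfl⟩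
    simp only [List.mem_cons, List.not_mem_nil, or_false, forall_eq_or_imp, forall_eq]
    exact ⟨rfl, (holds_deep (q := 3 * r + 2)).2 h3, fun hp => h4 (holds_deep.1 hp)⟩
  · rw [h] at hfst
    obtain rfl : 3 * r + 3 = q := hfst
    -- The implication required by a zero test is a disjunction, spread over two transitions.
    by_cases hinc : OccursBelow T β x (incL r) d
    · refine ⟨_, mem r hr ([.pos (.state (3 * r + 3)),
        .pos (.pathEq (deep (3 * R + 1) 1 (decL r)))], [.accept]) (by simp), ?_, rfl⟩
      simp only [List.mem_cons, List.not_mem_nil, or_false, forall_eq_or_imp, forall_eq]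
      exact ⟨rfl, (holds_deep (q := 3 * r + 3)).2 (hzero r h d hinc)⟩
    · refine ⟨_, mem r hr ([.pos (.state (3 * r + 3)),
        .neg (.pathEq (deep (3 * R + 1) 1 (incL r)))], [.accept]) (by simp), ?_, rfl⟩
      simp only [List.mem_cons, List.not_mem_nil, or_false, forall_eq_or_imp, forall_eq]
      exact ⟨rfl, fun hp => hinc (holds_deep.1 hp)⟩

theorem accepts_of_nodeCond
    (h1 : ∀ x, x ≠ T.root → (fullLetter T β x = (0, 0) ∧ T.IsLeaf x) ∨ IsInstr R (fullLetter T β x))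
    (h2 : ∀ x z, T.IsParent x z → NodeCond T β x z) {w : List (ℕ × ℕ)} {y₀ : T.Node}
    (h3 : T.DownPath (fullLetter T β) T.root w y₀) (hw : w ∈ e.matches') :
    (automaton R e).Accepts T := by
  have mem : ∀ r < R, ∀ τ, τ ∈ _ → τ ∈ rootCheck e :: checks R := fun r hr τ hτ =>
    List.mem_cons_of_mem _ (List.mem_cons_of_mem _
      (List.mem_flatMap.2 ⟨r, List.mem_range.2 hr, hτ⟩))
  have hchecks : ∀ {x q d}, (q, d) ∈ threads T (T.datum y₀) x → q ≠ 0 →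
    ∃ τ ∈ rootCheck e :: checks R, (∀ l ∈ τ.1, l.Holds T β x q d) ∧ τ.2 = [.accept] := by
    intro x q d h hq
    obtain ⟨τ, hτ, h⟩ := checks_of_nodeCond h1 h2 h hq
    exact ⟨τ, List.mem_cons_of_mem _ hτ, h⟩
  -- The initial register value is free. The datum at the end of the matching path is the one that
  -- makes `pathEq e` true at the root.
  refine ⟨β, threads T (T.datum y₀), ⟨finite_threads _, ?_, ?_, ?_⟩, ?_⟩
  · rintro x ⟨q, d⟩ (h | ⟨z, -, hq, -⟩)
    · rw [h]; exact Nat.succ_pos _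
    · rw [hq]; exact (T.letter z).2
  · refine fun x hx => ⟨T.datum y₀, Set.ext fun θ => ⟨?_, Or.inl⟩⟩
    rintro (h | ⟨z, hz, -⟩)
    · exact h
    · exact absurd hz (hx z)
  · intro x y hxy q d h
    by_cases hq : q = 0
    · subst hq
      obtain rfl : d = T.datum y₀ := by
        rcases h with h | ⟨z, -, -, h, -⟩
        · exact (Prod.mk.inj h).2
        · exact absurd rfl h
      have hkeep : (0, T.datum y₀) ∈ threads T (T.datum y₀) y := Or.inl rfl
      rcases h1 x hxy.ne_root with ⟨hx0, hleaf⟩ | ⟨r, hr, hx | hx | hx⟩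
      · refine ⟨([.pos (.state 0), .pos (.letter 0), .pos .leaf], [.keep 0]),
          List.mem_cons_of_mem _ List.mem_cons_self, ?_, ?_⟩
        · simp only [List.mem_cons, List.not_mem_nil, or_false, forall_eq_or_imp, forall_eq]
          exact ⟨rfl, congrArg Prod.fst hx0, hleaf⟩
        · simp only [List.mem_cons, List.not_mem_nil, or_false, forall_eq]
          exact hkeep
      · have hx' : (T.letter x : ℕ) = 3 * r + 1 := congrArg Prod.fst hx
        refine ⟨_, mem r hr ([.pos (.state 0), .pos (.letter (3 * r + 1))],
          [.keep 0, .store (3 * r + 1)]) (by simp), ?_, ?_⟩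
        · simp only [List.mem_cons, List.not_mem_nil, or_false, forall_eq_or_imp, forall_eq]
          exact ⟨rfl, hx'⟩
        · simp only [List.mem_cons, List.not_mem_nil, or_false, forall_eq_or_imp, forall_eq]
          exact ⟨hkeep, Or.inr ⟨x, hxy, hx'.symm, Nat.succ_ne_zero _, self_mem_dataBelow x,
            fun _ => rfl⟩⟩
      · have hx' : (T.letter x : ℕ) = 3 * r + 2 := congrArg Prod.fst hx
        refine ⟨_, mem r hr ([.pos (.state 0), .pos (.letter (3 * r + 2))],
          [.keep 0, .store (3 * r + 2)]) (by simp), ?_, ?_⟩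
        · simp only [List.mem_cons, List.not_mem_nil, or_false, forall_eq_or_imp, forall_eq]
          exact ⟨rfl, hx'⟩
        · simp only [List.mem_cons, List.not_mem_nil, or_false, forall_eq_or_imp, forall_eq]
          exact ⟨hkeep, Or.inr ⟨x, hxy, hx'.symm, Nat.succ_ne_zero _, self_mem_dataBelow x,
            fun _ => rfl⟩⟩
      · have hx' : (T.letter x : ℕ) = 3 * r + 3 := congrArg Prod.fst hx
        refine ⟨_, mem r hr ([.pos (.state 0), .pos (.letter (3 * r + 3))],
          [.keep 0, .univ (3 * r + 3)]) (by simp), ?_, ?_⟩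
        · simp only [List.mem_cons, List.not_mem_nil, or_false, forall_eq_or_imp, forall_eq]
          exact ⟨rfl, hx'⟩
        · simp only [List.mem_cons, List.not_mem_nil, or_false, forall_eq_or_imp, forall_eq]
          refine ⟨hkeep, fun d hd => Or.inr ⟨x, hxy, hx'.symm, Nat.succ_ne_zero _, hd,
            fun h => absurd ?_ h⟩⟩
          simp only
          omega
    · obtain ⟨τ, hτ, hl, ha⟩ := hchecks h hq
      refine ⟨τ, hτ, hl, ?_⟩
      rw [ha]
      simp only [List.mem_cons, List.not_mem_nil, or_false, forall_eq]
      trivial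
  · intro q d h
    by_cases hq : q = 0
    · subst hq
      obtain rfl : d = T.datum y₀ := by
        rcases h with h | ⟨z, -, -, h, -⟩
        · exact (Prod.mk.inj h).2
        · exact absurd rfl h
      refine ⟨rootCheck e, List.mem_cons_self, ?_, by simp [rootCheck]⟩
      simp only [rootCheck, List.mem_cons, List.not_mem_nil, or_false, forall_eq_or_imp, forall_eq]
      exact ⟨rfl, rfl, w, y₀, h3, hw, rfl⟩
    · obtain ⟨τ, hτ, hl, ha⟩ := hchecks h hq
      exact ⟨τ, hτ, hl, by simp [ha]⟩

end Completeness

/-- The label of a tree node for an entry of a data word. -/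
def toLabel (R : ℕ) (x : (ℕ × ℕ) × D) : Fin (3 * R + 1) × D := (Fin.ofNat (3 * R + 1) x.1.1, x.2)

theorem exists_accepts_of_dataValid {W : List ((ℕ × ℕ) × D)} {u : List (ℕ × ℕ)} (d₀ : D)
    (hWu : W.map Prod.fst = u ++ [(0, 0)]) (hu : ∀ c ∈ u, IsInstr R c) (hW : DataValid W)
    (he : (0, 0) :: (u ++ [(0, 0)]) ∈ e.matches') :
    ∃ T : DataTree (3 * R + 1) D, T.Unary ∧ (automaton R e).Accepts T := by
  -- The added entry is the root marker, with an arbitrary datum: the latest instruction needs a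
  -- parent to carry its checks. A node of depth `i` then bears entry `i` of `W₀`.
  let W₀ : List ((ℕ × ℕ) × D) := ((0, 0), d₀) :: W
  let g : Fin (3 * R + 1) × D → (ℕ × ℕ) × D := fun a => ((a.1, 0), a.2)
  have hg : ∀ x ∈ W₀, g (toLabel R x) = x := by
    rintro ⟨c, d⟩ hx
    have hc : c = (0, 0) ∨ IsInstr R c := by
      rcases List.mem_cons.1 hx with h | h
      · exact Or.inl (Prod.mk.inj h).1
      · have : c ∈ u ++ [(0, 0)] := hWu ▸ List.mem_map_of_mem (f := Prod.fst) h
        rcases List.mem_append.1 this with h | h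
        · exact Or.inr (hu c h)
        · exact Or.inl (by simpa using h)
    have hc' : c.1 < 3 * R + 1 ∧ c.2 = 0 := by
      rcases hc with rfl | ⟨r, hr, rfl | rfl | rfl⟩ <;> simp [incL, decL, zeroL] <;> omega
    obtain ⟨a, b⟩ := c
    obtain ⟨h1, h2⟩ := hc'
    simp only at h1 h2
    subst h2
    simp only [g, toLabel, Fin.val_ofNat, Nat.mod_eq_of_lt h1]
  let L : List (Fin (3 * R + 1) × D) := W₀.map (toLabel R)
  have hL : L ≠ [] := by simp [L, W₀]
  let T : DataTree (3 * R + 1) D := UTree.ofList L hL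
  let β : T.Node → Fin 1 := fun _ => 0
  have hgL : L.map g = W₀ := by
    rw [List.map_map]
    conv_rhs => rw [← List.map_id W₀]
    exact List.map_congr_left hg
  have hlenL : L.length = W₀.length := by simp [L]
  have hlenW : W₀.length = u.length + 2 := by
    have := congrArg List.length hWu
    simp at this
    simp [W₀, this]
  have hentry : ∀ x : T.Node, W₀[x.1.length]? = some (entry T β x) := by
    intro x
    have hx := (UTree.mem_ofList.1 x.2).1
    rw [← hgL, List.getElem?_map, List.getElem?_eq_getElem hx]
    rfl
  have hnode : ∀ i < W₀.length, ∃ x : T.Node, x.1.length = i := fun i hi =>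
    ⟨UTree.ofListNode L hL i (hlenL ▸ hi), List.length_replicate⟩
  have hoccurs : ∀ x c d, OccursBelow T β x c d ↔ (c, d) ∈ W₀.drop (x.1.length + 2) := by
    intro x c d
    rw [List.mem_iff_getElem?]
    simp only [List.getElem?_drop]
    constructor
    · rintro ⟨y, hxy, hl, rfl, rfl⟩
      refine ⟨y.1.length - (x.1.length + 2), ?_⟩
      rw [Nat.add_sub_cancel' hl, hentry]
      rfl
    · rintro ⟨i, hi⟩
      obtain ⟨hlt, -⟩ := List.getElem?_eq_some_iff.1 hi
      obtain ⟨y, hy⟩ := hnode _ hlt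
      rw [← hy, hentry, Option.some_inj] at hi
      exact ⟨y, UTree.ofList_prefix_iff.2 (by omega), by omega, (Prod.mk.inj hi).1,
        (Prod.mk.inj hi).2⟩
  refine ⟨T, UTree.unary_ofList, ?_⟩
  obtain ⟨y₀, -, hpath⟩ := UTree.downPath_ofList (hL := hL) (fun a => (g a).1) T.root
  have hword : (L.drop T.root.1.length).map (fun a => (g a).1) = (0, 0) :: (u ++ [(0, 0)]) := by
    change L.map (Prod.fst ∘ g) = _
    rw [← List.map_map, hgL, List.map_cons, hWu]
  rw [hword] at hpath
  refine accepts_of_nodeCond (β := β) ?_ ?_ hpath he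
  · intro x hx
    have hxlen : x.1.length ≠ 0 := fun h => hx (Subtype.ext (List.length_eq_zero_iff.1 h))
    obtain ⟨i, hi⟩ := Nat.exists_eq_succ_of_ne_zero hxlen
    have h := congrArg (Option.map Prod.fst) (hentry x)
    have h' : (u ++ [(0, 0)])[i]? = some (fullLetter T β x) := by
      rw [← hWu, List.getElem?_map]
      refine Eq.trans ?_ h
      rw [hi]
      rfl
    obtain ⟨hlt, -⟩ := List.getElem?_eq_some_iff.1 h'
    rw [List.length_append, List.length_singleton] at hlt
    rcases Nat.lt_succ_iff_lt_or_eq.1 hlt with h | h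
    · right
      rw [List.getElem?_append_left h] at h'
      exact hu _ (List.mem_of_getElem? h')
    · left
      subst h
      rw [List.getElem?_append_right le_rfl, Nat.sub_self] at h'
      refine ⟨(Option.some_inj.1 h').symm, UTree.ofList_isLeaf_iff.2 ?_⟩
      rw [hlenL, hlenW]
      omega
  · intro x z hxz
    have hz := hentry z
    obtain ⟨hlt, hget⟩ := List.getElem?_eq_some_iff.1 hz
    have hlen := hxz.length
    -- Because of the root marker, the index of `z` in `W` is the depth of its parent `x`.
    have hsplit : W = W.take x.1.length ++ entry T β z :: W₀.drop (x.1.length + 2) := by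
      have h1 : x.1.length < W.length := by
        have : W₀.length = W.length + 1 := rfl
        omega
      have h2 : W[x.1.length] = entry T β z := by
        rw [← hget]
        simp only [hlen]
        rfl
      conv_lhs => rw [← List.take_append_drop x.1.length W, List.drop_eq_getElem_cons h1, h2]
      rfl
    rw [hsplit] at hW
    obtain ⟨hi, hd, hzero⟩ := hW.cond_of_append
    refine ⟨fun r hr h => hi r hr ((hoccurs _ _ _).1 h), fun r hr =>
      ⟨(hoccurs _ _ _).2 (hd r hr).1, fun h => (hd r hr).2 ((hoccurs _ _ _).1 h)⟩,
      fun r hr d h => (hoccurs _ _ _).2 (hzero r hr d ((hoccurs _ _ _).1 h))⟩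

theorem valid_append_marker {u : List (ℕ × ℕ)} : Valid (u ++ [(0, 0)]) ↔ Valid u := by
  induction u with
  | nil => simp [Valid, decL, zeroL]
  | cons c u ih => simp [Valid, ih, incL, decL]

theorem exists_accepts_iff [Infinite D]
    (he : ∀ w ∈ e.matches', ∃ u, w = (0, 0) :: (u ++ [(0, 0)]) ∧ ∀ c ∈ u, IsInstr R c) :
    (∃ T : DataTree (3 * R + 1) D, T.Unary ∧ (automaton R e).Accepts T) ↔
      ∃ u, (0, 0) :: (u ++ [(0, 0)]) ∈ e.matches' ∧ ∃ s, Run (fun _ => 0) u s := by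
  constructor
  · rintro ⟨T, hT, h⟩
    obtain ⟨u, hu, hv⟩ := exists_valid_of_accepts
      (fun w hw => (he w hw).imp fun u hu => hu.1) hT h
    obtain ⟨u', hu', hi⟩ := he _ hu
    obtain rfl : u = u' := (List.append_inj' (List.cons.inj hu').2 rfl).1
    exact ⟨u, hu, exists_run_of_valid hi (valid_append_marker.1 hv)⟩
  · rintro ⟨u, hu, s, hs⟩
    obtain ⟨u', hu', hi⟩ := he _ hu
    obtain rfl : u = u' := (List.append_inj' (List.cons.inj hu').2 rfl).1
    let φ := Infinite.natEmbedding D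
    exact exists_accepts_of_dataValid (φ 0) (map_fst_annotate φ _) hi
      ((valid_append_marker.2 (valid_of_run hs).1).dataValid_annotate φ) hu

end Counter

/-! ### The automaton recognizing the trees that are not unary -/

namespace Buda

open RegularExpression

/-- Words whose last letter has the internal letter `i`. -/
def lastInternal (k m i : ℕ) : Regex :=
  (oneOf (allLetters k m)).star * oneOf ((List.range k).map fun a => (a, i))

/-- Words with internal letter `j` at the last position and `i` at an earlier one. -/
def twoInternal (k m i j : ℕ) : Regex :=
  (oneOf (allLetters k m)).star *
    (oneOf ((List.range k).map fun a => (a, i)) * lastInternal k m j)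

theorem inRange_lastInternal {k m i : ℕ} (hi : i < m) :
    Regex.InRange k m (lastInternal k m i) :=
  ⟨inRange_oneOf fun _ hc => mem_allLetters.1 hc, inRange_oneOf (by simpa using fun _ h => ⟨h, hi⟩)⟩

theorem inRange_twoInternal {k m i j : ℕ} (hi : i < m) (hj : j < m) :
    Regex.InRange k m (twoInternal k m i j) :=
  ⟨inRange_oneOf fun _ hc => mem_allLetters.1 hc, inRange_oneOf (by simpa using fun _ h => ⟨h, hi⟩),
    inRange_lastInternal hj⟩

theorem mem_lastInternal {k m i : ℕ} {w : List (ℕ × ℕ)} :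
    w ∈ (lastInternal k m i).matches' ↔
      ∃ u c, w = u ++ [c] ∧ (∀ a ∈ u, a ∈ allLetters k m) ∧ c.1 < k ∧ c.2 = i := by
  simp only [lastInternal, matches'_mul, Language.mem_mul, mem_oneOf, mem_star_oneOf,
    List.mem_map, List.mem_range]
  constructor
  · rintro ⟨u, hu, _, ⟨_, ⟨a, ha, rfl⟩, rfl⟩, rfl⟩
    exact ⟨u, (a, i), rfl, hu, ha, rfl⟩
  · rintro ⟨u, ⟨a, b⟩, rfl, hu, ha, rfl⟩
    exact ⟨u, hu, _, ⟨_, ⟨a, ha, rfl⟩, rfl⟩, rfl⟩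

theorem mem_twoInternal {k m i j : ℕ} {w : List (ℕ × ℕ)} :
    w ∈ (twoInternal k m i j).matches' ↔
      ∃ u c v c', w = u ++ c :: (v ++ [c']) ∧ (∀ a ∈ u, a ∈ allLetters k m) ∧ (c.1 < k ∧ c.2 = i) ∧
        (∀ a ∈ v, a ∈ allLetters k m) ∧ c'.1 < k ∧ c'.2 = j := by
  rw [twoInternal, matches'_mul, Language.mem_mul]
  simp only [matches'_mul, Language.mem_mul, mem_oneOf, mem_star_oneOf, mem_lastInternal,
    List.mem_map, List.mem_range]
  constructor
  · rintro ⟨u, hu, _, ⟨_, ⟨_, ⟨a, ha, rfl⟩, rfl⟩, _, ⟨v, c', rfl, hv, hc'⟩, rfl⟩, rfl⟩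
    exact ⟨u, (a, i), v, c', rfl, hu, ⟨ha, rfl⟩, hv, hc'⟩
  · rintro ⟨u, ⟨a, b⟩, v, c', rfl, hu, ⟨ha, rfl⟩, hv, hc'⟩
    exact ⟨u, hu, _, ⟨_, ⟨_, ⟨a, ha, rfl⟩, rfl⟩, _, ⟨v, c', rfl, hv, hc'⟩, rfl⟩, rfl⟩

section

variable {k m : ℕ} {D : Type*} {T : DataTree k D} {β : T.Node → Fin m}

theorem forall_mem_map_fullLetter (L : List T.Node) :
    ∀ a ∈ L.map (fullLetter T β), a ∈ allLetters k m := by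
  intro a ha
  obtain ⟨z, -, rfl⟩ := List.mem_map.1 ha
  exact fullLetter_mem z

theorem internal_of_lastInternal {i : ℕ} {x y : T.Node} {w : List (ℕ × ℕ)}
    (h : T.DownPath (fullLetter T β) x w y) (hw : w ∈ (lastInternal k m i).matches') :
    (β y : ℕ) = i := by
  obtain ⟨L, hL, rfl⟩ := h.exists_nodes
  obtain ⟨M, rfl⟩ := hL.exists_append
  obtain ⟨u, c, hu, -, -, hc⟩ := mem_lastInternal.1 hw
  rw [List.map_append] at hu
  rw [← hc, ← List.singleton_inj.1 (List.append_inj' hu rfl).2]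
  rfl

theorem exists_path_lastInternal (y : T.Node) :
    ∃ w, T.DownPath (fullLetter T β) T.root w y ∧ w ∈ (lastInternal k m (β y)).matches' := by
  obtain ⟨L, hL⟩ := UTree.DownPath.exists_of_prefix (UTree.root_prefix y)
  refine ⟨_, hL.map (fullLetter T β), ?_⟩
  obtain ⟨M, rfl⟩ := hL.exists_append
  exact mem_lastInternal.2 ⟨M.map (fullLetter T β), fullLetter T β y, by simp,
    forall_mem_map_fullLetter M, (T.letter y).2, rfl⟩

theorem internal_of_twoInternal {i j : ℕ} {x z : T.Node} {w : List (ℕ × ℕ)}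
    (h : T.DownPath (fullLetter T β) x w z) (hw : w ∈ (twoInternal k m i j).matches') :
    ∃ y : T.Node, y.1 <+: z.1 ∧ (β y : ℕ) = i ∧ (β z : ℕ) = j := by
  obtain ⟨L, hL, rfl⟩ := h.exists_nodes
  obtain ⟨u, c, v, c', huv, -, ⟨-, hc⟩, -, -, hc'⟩ := mem_twoInternal.1 hw
  obtain ⟨L₁, L₂, rfl, rfl, h₂⟩ := List.map_eq_append_iff.1 huv
  obtain ⟨y, L₃, rfl, rfl, h₃⟩ := List.map_eq_cons_iff.1 h₂
  have hp := hL.of_append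
  refine ⟨y, hp.prefix_end, hc, ?_⟩
  obtain ⟨M, hM⟩ := hp.exists_append
  have h4 : (y :: L₃).map (fullLetter T β) = fullLetter T β y :: v ++ [c'] := by simp [h₃]
  rw [hM, List.map_append] at h4
  rw [← hc', ← List.singleton_inj.1 (List.append_inj' h4 rfl).2]
  rfl

theorem exists_path_twoInternal {y z : T.Node} (hyz : y.1 <+: z.1) (hne : y ≠ z) :
    ∃ w, T.DownPath (fullLetter T β) T.root w z ∧
      w ∈ (twoInternal k m (β y) (β z)).matches' := by
  obtain ⟨L, hL⟩ := UTree.DownPath.exists_of_prefix (UTree.root_prefix y)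
  obtain ⟨L', hL'⟩ := UTree.DownPath.exists_of_prefix hyz
  obtain ⟨M, rfl⟩ := hL.exists_append
  obtain ⟨N, rfl⟩ := hL'.exists_cons
  refine ⟨_, (hL.trans hL').map (fullLetter T β), ?_⟩
  obtain ⟨N', hN'⟩ := hL'.exists_append
  cases N' with
  | nil => exact absurd (List.cons.inj hN').1 hne
  | cons a N' =>
    obtain ⟨rfl, rfl⟩ := List.cons.inj hN'
    exact mem_twoInternal.2 ⟨M.map (fullLetter T β), fullLetter T β y, N'.map (fullLetter T β),
      fullLetter T β z, by simp, forall_mem_map_fullLetter M, ⟨(T.letter y).2, rfl⟩,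
      forall_mem_map_fullLetter N', (T.letter z).2, rfl⟩

end

/-- No node with internal letter `1` is above or below one with internal letter `2`. -/
def incomparable (k : ℕ) : List Literal :=
  [.neg (.pathEq (twoInternal k 3 1 2)), .neg (.pathNe (twoInternal k 3 1 2)),
    .neg (.pathEq (twoInternal k 3 2 1)), .neg (.pathNe (twoInternal k 3 2 1))]

/-- An automaton guessing two incomparable nodes. -/
def branching (k : ℕ) : BUDA := ⟨k, 3, 1, 0, [
  ([.pos (.state 0)], [.keep 0]),
  (.pos .root :: .pos (.pathEq (lastInternal k 3 1)) :: .pos (.pathEq (lastInternal k 3 2)) ::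
    incomparable k, [.accept]),
  (.pos .root :: .pos (.pathEq (lastInternal k 3 1)) :: .pos (.pathNe (lastInternal k 3 2)) ::
    incomparable k, [.accept])]⟩

theorem branching_wellFormed (k : ℕ) : (branching k).WellFormed := by
  have h1 : Regex.InRange k 3 (lastInternal k 3 1) := inRange_lastInternal (by omega)
  have h2 : Regex.InRange k 3 (lastInternal k 3 2) := inRange_lastInternal (by omega)
  have h3 : Regex.InRange k 3 (twoInternal k 3 1 2) := inRange_twoInternal (by omega) (by omega)
  have h4 : Regex.InRange k 3 (twoInternal k 3 2 1) := inRange_twoInternal (by omega) (by omega)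
  constructor
  · exact Nat.one_pos
  · simp [branching, incomparable, Literal.InRange, BasicTest.InRange, h1, h2, h3, h4]
  · simp [branching, BasicAction.InRange]
  · simp [branching]

variable {k : ℕ} {D : Type*} {T : DataTree k D}

/-- Acceptance requires nodes with internal letters `1` and `2`; in a unary tree they are
comparable, which produces a forbidden path. Each pattern is forbidden for both `pathEq` and
`pathNe`, so the register does not matter. -/
theorem branching_not_accepts_of_unary (hT : T.Unary) : ¬ (branching k).Accepts T := by
  rintro ⟨β, ρ, hρ, hacc⟩
  obtain ⟨d, hd⟩ := hρ.exists_init (by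
    intro x d hx τ hτ hl
    simp only [branching, List.mem_cons, List.not_mem_nil, or_false] at hτ
    rcases hτ with rfl | rfl | rfl
    · exact List.mem_cons_self
    all_goals exact absurd (hl (.pos .root) (by simp)) hx) T.root
  have key : ∀ y₁ y₂ : T.Node, (β y₁ : ℕ) = 1 → (β y₂ : ℕ) = 2 →
      ¬ ∀ l ∈ incomparable k, l.Holds T β T.root 0 d := by
    intro y₁ y₂ h1 h2 hl
    simp only [incomparable, List.mem_cons, List.not_mem_nil, or_false, forall_eq_or_imp,
      forall_eq] at hl
    obtain ⟨ha, hb, hc, hd⟩ := hl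
    have hne : y₁ ≠ y₂ := by
      rintro rfl
      omega
    rcases hT.prefix_or_prefix y₁ y₂ with h | h
    · obtain ⟨w, hp, hw⟩ := exists_path_twoInternal (β := β) h hne
      rw [h1, h2] at hw
      by_cases hdat : T.datum y₂ = d
      · exact ha ⟨w, y₂, hp, hw, hdat⟩
      · exact hb ⟨w, y₂, hp, hw, hdat⟩
    · obtain ⟨w, hp, hw⟩ := exists_path_twoInternal (β := β) h hne.symm
      rw [h1, h2] at hw
      by_cases hdat : T.datum y₁ = d
      · exact hc ⟨w, y₁, hp, hw, hdat⟩
      · exact hd ⟨w, y₁, hp, hw, hdat⟩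
  obtain ⟨τ, hτ, hl, ha⟩ := hacc _ _ hd
  simp only [branching, List.mem_cons, List.not_mem_nil, or_false] at hτ
  rcases hτ with rfl | rfl | rfl
  · simp at ha
  all_goals
    simp only [List.forall_mem_cons] at hl
    obtain ⟨-, ⟨w₁, y₁, hp₁, hw₁, -⟩, ⟨w₂, y₂, hp₂, hw₂, -⟩, hl⟩ := hl
    exact key y₁ y₂ (internal_of_lastInternal hp₁ hw₁) (internal_of_lastInternal hp₂ hw₂) hl

/-- Two adjacent siblings receive the internal letters `1` and `2`. The register holds the datum of
the first, and the two accepting transitions cover the cases where the datum of the second is equal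
or different. -/
theorem branching_accepts_of_not_unary (hT : ¬ T.Unary) : (branching k).Accepts T := by
  classical
  simp only [UTree.Unary, not_forall] at hT
  obtain ⟨p, i, hi, hne⟩ := hT
  obtain ⟨j, rfl⟩ := Nat.exists_eq_succ_of_ne_zero hne
  let y₁ : T.Node := ⟨p ++ [j], T.sibling_closed p j hi⟩
  let y₂ : T.Node := ⟨p ++ [j + 1], hi⟩
  have h12 : y₂ ≠ y₁ := fun h => by simpa [y₁, y₂] using congrArg Subtype.val h
  have hlen : y₁.1.length = y₂.1.length := by simp [y₁, y₂]
  let β : T.Node → Fin 3 := fun z => if z = y₁ then 1 else if z = y₂ then 2 else 0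
  have hβ1 : ∀ z, (β z : ℕ) = 1 → z = y₁ := by
    intro z hz
    by_contra h
    by_cases h' : z = y₂ <;> simp [β, h, h', h12] at hz
  have hβ2 : ∀ z, (β z : ℕ) = 2 → z = y₂ := by
    intro z hz
    by_contra h
    by_cases h' : z = y₁ <;> simp [β, h, h'] at hz
  have hy₁ : (β y₁ : ℕ) = 1 := by simp [β]
  have hy₂ : (β y₂ : ℕ) = 2 := by simp [β, h12]
  have hinc : ∀ l ∈ incomparable k, l.Holds T β T.root 0 (T.datum y₁) := by
    have key : ∀ a b : T.Node, a.1.length = b.1.length → a ≠ b → ¬ a.1 <+: b.1 :=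
      fun a b h hne h' => hne (Subtype.ext (h'.eq_of_length h))
    have h1 : ∀ w z, T.DownPath (fullLetter T β) T.root w z →
        w ∉ (twoInternal k 3 1 2).matches' := by
      intro w z hp hw
      obtain ⟨y, hyz, h1, h2⟩ := internal_of_twoInternal hp hw
      rw [hβ1 y h1, hβ2 z h2] at hyz
      exact key _ _ hlen h12.symm hyz
    have h2 : ∀ w z, T.DownPath (fullLetter T β) T.root w z →
        w ∉ (twoInternal k 3 2 1).matches' := by
      intro w z hp hw
      obtain ⟨y, hyz, h1, h2⟩ := internal_of_twoInternal hp hw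
      rw [hβ2 y h1, hβ1 z h2] at hyz
      exact key _ _ hlen.symm h12 hyz
    simp only [incomparable, List.mem_cons, List.not_mem_nil, or_false, forall_eq_or_imp,
      forall_eq]
    exact ⟨fun ⟨w, z, hp, hw, _⟩ => h1 w z hp hw, fun ⟨w, z, hp, hw, _⟩ => h1 w z hp hw,
      fun ⟨w, z, hp, hw, _⟩ => h2 w z hp hw, fun ⟨w, z, hp, hw, _⟩ => h2 w z hp hw⟩
  have hp1 := exists_path_lastInternal (β := β) y₁
  have hp2 := exists_path_lastInternal (β := β) y₂
  rw [hy₁] at hp1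
  rw [hy₂] at hp2
  obtain ⟨w₁, hp₁, hw₁⟩ := hp1
  obtain ⟨w₂, hp₂, hw₂⟩ := hp2
  refine ⟨β, fun _ => {(0, T.datum y₁)}, ⟨fun _ => Set.finite_singleton _, ?_, ?_, ?_⟩, ?_⟩
  · rintro x θ rfl
    exact Nat.one_pos
  · exact fun x _ => ⟨_, rfl⟩
  · rintro x y - q d h
    obtain ⟨rfl, rfl⟩ := Prod.mk.inj h
    refine ⟨([.pos (.state 0)], [.keep 0]), List.mem_cons_self, ?_, ?_⟩
    · simp only [List.mem_cons, List.not_mem_nil, or_false, forall_eq]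
      rfl
    · simp only [List.mem_cons, List.not_mem_nil, or_false, forall_eq]
      rfl
  · intro q d h
    obtain ⟨rfl, rfl⟩ := Prod.mk.inj h
    by_cases hdat : T.datum y₂ = T.datum y₁
    · refine ⟨_, List.mem_cons_of_mem _ List.mem_cons_self, ?_, by simp⟩
      simp only [List.forall_mem_cons]
      exact ⟨rfl, ⟨w₁, y₁, hp₁, hw₁, rfl⟩, ⟨w₂, y₂, hp₂, hw₂, hdat⟩, hinc⟩
    · refine ⟨_, List.mem_cons_of_mem _ (List.mem_cons_of_mem _ List.mem_cons_self), ?_, by simp⟩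
      simp only [List.forall_mem_cons]
      exact ⟨rfl, ⟨w₁, y₁, hp₁, hw₁, rfl⟩, ⟨w₂, y₂, hp₂, hw₂, hdat⟩, hinc⟩

theorem branching_accepts_iff : (branching k).Accepts T ↔ ¬ T.Unary :=
  ⟨fun h hT => branching_not_accepts_of_unary hT h, branching_accepts_of_not_unary⟩

end Buda

/-! ### Computability of the reduction and undecidability -/

namespace Buda

theorem primrec₂_comp : Primrec₂ (RegularExpression.comp : Regex → Regex → Regex) := by
  have h : Primrec fun p : Regex × Regex =>
      4 * Nat.pair (Encodable.encode p.1) (Encodable.encode p.2) + 4 :=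
    Primrec.nat_add.comp (Primrec.nat_mul.comp (.const 4)
      (Primrec₂.natPair.comp (Primrec.encode.comp .fst) (Primrec.encode.comp .snd))) (.const 4)
  exact Primrec.encode_iff.1 h

/-- `n` increments of the counter `0`, executed after a marker. -/
def inputExpr (n : ℕ) : Regex :=
  Nat.rec (.char (0, 0)) (fun _ e => .comp (.char (Counter.incL 0)) e) n

theorem primrec_inputExpr : Primrec inputExpr :=
  Primrec.nat_rec₁ _ (primrec₂_comp.comp (.const _) .snd).to₂

theorem mem_inputExpr {n : ℕ} {w : List (ℕ × ℕ)} :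
    w ∈ (inputExpr n).matches' ↔ w = List.replicate n (Counter.incL 0) ++ [(0, 0)] := by
  induction n generalizing w with
  | zero => exact Iff.rfl
  | succ n ih =>
    change w ∈ (RegularExpression.char (Counter.incL 0) * inputExpr n).matches' ↔ _
    rw [RegularExpression.matches'_mul, Language.mem_mul]
    simp only [ih]
    constructor
    · rintro ⟨a, ha, _, rfl, rfl⟩
      obtain rfl : a = [Counter.incL 0] := ha
      simp [List.replicate_succ]
    · rintro rfl
      exact ⟨[Counter.incL 0], rfl, _, rfl, by simp [List.replicate_succ]⟩

theorem inRange_inputExpr {k : ℕ} (hk : 1 < k) (n : ℕ) : Regex.InRange k 1 (inputExpr n) := by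
  induction n with
  | zero => exact ⟨by simp; omega, Nat.one_pos⟩
  | succ n ih => exact ⟨⟨hk, Nat.one_pos⟩, ih⟩

end Buda

namespace Counter

open Buda

theorem Prog.inRange_traces (P : Prog) {R : ℕ} (h : P.bound ≤ R) :
    Regex.InRange (3 * R + 1) 1 P.traces := by
  induction P with
  | skip => trivial
  | inc r =>
    simp only [bound] at h
    exact ⟨by simp [incL]; omega, Nat.one_pos⟩
  | seq P Q ihP ihQ =>
    simp only [bound, max_le_iff] at h
    exact ⟨ihQ h.2, ihP h.1⟩
  | loop r P ih =>
    simp only [bound, max_le_iff] at h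
    exact ⟨⟨by simp [zeroL]; omega, Nat.one_pos⟩, ih h.2, by simp [decL]; omega, Nat.one_pos⟩

/-- The traces of `P` with input `n`, between two markers. -/
def Prog.runExpr (P : Prog) (n : ℕ) : Regex :=
  .comp (.char (0, 0)) (.comp P.traces (inputExpr n))

theorem Prog.mem_runExpr {P : Prog} {n : ℕ} {w : List (ℕ × ℕ)} :
    w ∈ (P.runExpr n).matches' ↔
      ∃ u ∈ P.traces.matches', w = (0, 0) :: (u ++ List.replicate n (incL 0) ++ [(0, 0)]) := by
  change w ∈ (RegularExpression.char (0, 0) * (P.traces * inputExpr n)).matches' ↔ _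
  simp only [RegularExpression.matches'_mul, Language.mem_mul, mem_inputExpr]
  constructor
  · rintro ⟨a, ha, _, ⟨u, hu, _, rfl, rfl⟩, rfl⟩
    obtain rfl : a = [(0, 0)] := ha
    exact ⟨u, hu, by simp⟩
  · rintro ⟨u, hu, rfl⟩
    exact ⟨[(0, 0)], rfl, _, ⟨u, hu, _, rfl, rfl⟩, by simp⟩

/-- The automaton for the runs of `P` on input `n`. -/
def Prog.automaton (P : Prog) (n : ℕ) : BUDA := Counter.automaton (max 1 P.bound) (P.runExpr n)

theorem Prog.automaton_wellFormed (P : Prog) (n : ℕ) : (P.automaton n).WellFormed :=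
  Counter.automaton_wellFormed ⟨⟨Nat.succ_pos _, Nat.one_pos⟩, P.inRange_traces (le_max_right _ _),
    inRange_inputExpr (by have := le_max_left 1 P.bound; omega) n⟩

theorem Prog.exists_automaton_accepts_iff {D : Type*} [Infinite D] (P : Prog) (n : ℕ) :
    (∃ T : DataTree (P.automaton n).numLetters D, T.Unary ∧ (P.automaton n).Accepts T) ↔
      ∃ s', P.Exec (Function.update (fun _ => 0) 0 n) s' := by
  rw [P.exists_exec_iff]
  refine (exists_accepts_iff (e := P.runExpr n) ?_).trans ?_
  · intro w hw
    obtain ⟨u, hu, rfl⟩ := mem_runExpr.1 hw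
    refine ⟨_, rfl, fun c hc => ?_⟩
    rcases List.mem_append.1 hc with h | h
    · exact (P.isInstr_of_mem_traces hu c h).mono (le_max_right _ _)
    · exact ⟨0, Nat.one_pos.trans_le (le_max_left _ _), Or.inl (List.eq_of_mem_replicate h)⟩
  · constructor
    · rintro ⟨u, hu, h⟩
      obtain ⟨v, hv, huv⟩ := mem_runExpr.1 hu
      obtain rfl := (List.append_inj' (List.cons.inj huv).2 rfl).1
      exact ⟨v, hv, h⟩
    · rintro ⟨v, hv, h⟩
      exact ⟨_, mem_runExpr.2 ⟨v, hv, rfl⟩, h⟩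

/-- The input enters only through the expression in `rootCheck`; the alphabet, the states and
`checks` are constants of the program. -/
theorem Prog.computable_automaton (P : Prog) : Computable P.automaton := by
  have he : Primrec P.runExpr :=
    primrec₂_comp.comp (.const _) (primrec₂_comp.comp (.const _) primrec_inputExpr)
  have htest : Primrec fun n => BasicTest.pathEq (P.runExpr n) :=
    (Primrec.of_equiv_symm (e := BasicTest.equiv)).comp
      (Primrec.sumInr.comp (Primrec.sumInr.comp (Primrec.sumInl.comp he)))
  have hlit : Primrec fun n => Literal.pos (.pathEq (P.runExpr n)) :=
    (Primrec.of_equiv_symm (e := Literal.equiv)).comp (Primrec.sumInl.comp htest)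
  have hroot : Primrec fun n => rootCheck (P.runExpr n) :=
    Primrec.pair (Primrec.list_cons.comp (.const (Literal.pos (.state 0))) (Primrec.list_cons.comp
      (.const (Literal.pos .root)) (Primrec.list_cons.comp hlit (.const [])))) (.const [BasicAction.accept])
  have : Primrec P.automaton :=
    (Primrec.of_equiv_symm (e := BUDA.equiv)).comp
      (Primrec.pair (.const _) (Primrec.pair (.const _) (Primrec.pair (.const _)
        (Primrec.pair (.const _) (Primrec.list_cons.comp hroot
          (.const (checks (max 1 P.bound))))))))
  exact this.to_comp

open Nat.Partrec in
/-- A counter program that halts exactly on the codes of functions defined at `0`. -/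
theorem exists_prog_halting : ∃ P : Prog, ∀ c : Code,
    (∃ s', P.Exec (Function.update (fun _ => 0) 0 (Encodable.encode c)) s') ↔
      (c.eval 0).Dom := by
  -- Success within the bound `k` is coded by `0`, since the search looks for a zero.
  let g : ℕ → ℕ → ℕ := fun k n => (Code.evaln k (Denumerable.ofNat Code n) 0).elim 1 fun _ => 0
  have hg : Primrec₂ g := by
    have h : Primrec fun p : ℕ × ℕ => Code.evaln p.1 (Denumerable.ofNat Code p.2) 0 :=
      Code.primrec_evaln.comp (Primrec.pair (Primrec.pair .fst ((Primrec.ofNat Code).comp .snd))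
        (.const 0))
    refine (Primrec.option_casesOn h (.const 1) (Primrec.const 0).to₂).of_eq fun p => ?_
    simp only [g]
    cases Code.evaln p.1 (Denumerable.ofNat Code p.2) 0 <;> rfl
  obtain ⟨P, hP⟩ := Prog.exists_search hg fun k n => by
    simp only [g]
    cases Code.evaln k (Denumerable.ofNat Code n) 0 <;> simp
  refine ⟨P, fun c => (hP _).trans ?_⟩
  simp only [g, Denumerable.ofNat_encode, Part.dom_iff_mem, Code.evaln_complete]
  rw [exists_comm]
  refine exists_congr fun k => ?_
  cases Code.evaln k c 0 <;> simp

end Counter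

theorem mainTheorem6 {C : Type*} [Primcodable C] {D : Type*} [Infinite D]
    (M : AutomataClass C D) (hext : M.ExtendsBUDA)
    (hcompl : M.ClosedUnderEffectiveCompl) (hinter : M.ClosedUnderEffectiveInter) :
    ¬ M.EmptinessDecidable := by
  classical
  rintro ⟨g, hg, hgM⟩
  obtain ⟨fe, hfe, hfeM⟩ := hext
  obtain ⟨fc, hfc, hfcM⟩ := hcompl
  obtain ⟨fi, hfi, hfiM⟩ := hinter
  obtain ⟨P, hP⟩ := Counter.exists_prog_halting
  -- This is the alphabet of the trace automata of `P`, the same for all inputs. The code `b'` for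
  -- the unary trees is thus a constant of the reduction, and complementation is applied only once.
  let B : BUDA := Buda.branching (3 * max 1 P.bound + 1)
  obtain ⟨b, -, hb, hbL⟩ := hfeM B (Buda.branching_wellFormed _)
  obtain ⟨b', -, hb', hbL'⟩ := hfcM b hb
  rw [hbL] at hbL'
  refine ComputablePred.halting_problem 0 (ComputablePred.computable_iff.2 ?_)
  -- The composite is a priori partial, because the three algorithms promise nothing outside the
  -- class; `hspec` shows that it is defined on every code.
  let h : Nat.Partrec.Code →. Bool := fun c =>
    (fe (P.automaton (Encodable.encode c))).bind fun a => (fi (a, b')).bind g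
  have hh : Partrec h := by
    have h1 : Partrec fun c : Nat.Partrec.Code => fe (P.automaton (Encodable.encode c)) :=
      hfe.comp (P.computable_automaton.comp Computable.encode)
    have h2 : Partrec fun a : C => (fi (a, b')).bind g :=
      (hfi.comp (Computable.pair .id (.const b'))).bind (hg.comp Computable.snd).to₂
    exact h1.bind (h2.comp Computable.snd).to₂
  have hspec : ∀ c, (!decide (c.eval 0).Dom) ∈ h c := by
    intro c
    let A := P.automaton (Encodable.encode c)
    obtain ⟨a, haf, ha, haL⟩ := hfeM A (P.automaton_wellFormed _)
    obtain ⟨i, hif, hi, hiL⟩ := hfiM a ha b' hb' _ _ _ haL hbL'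
    obtain ⟨v, hv, hvi⟩ := hgM i hi
    refine Part.mem_bind haf (Part.mem_bind hif ?_)
    have hempty : (M.lang i).2 = ∅ ↔ ¬ (c.eval 0).Dom := by
      rw [hiL, ← hP c, ← Counter.Prog.exists_automaton_accepts_iff (D := D),
        Set.eq_empty_iff_forall_notMem, not_exists]
      refine forall_congr' fun T => not_congr ?_
      have : B.Accepts T ↔ ¬ T.Unary := Buda.branching_accepts_iff
      change A.Accepts T ∧ ¬ B.Accepts T ↔ _
      rw [this, not_not, and_comm]
    rw [hempty] at hvi
    have : v = !decide (c.eval 0).Dom := by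
      cases v <;> simpa using hvi
    exact this ▸ hv
  have hcomp : Computable fun c : Nat.Partrec.Code => !decide (c.eval 0).Dom :=
    hh.of_eq fun c => Part.eq_some_iff.2 (hspec c)
  exact ⟨_, (Primrec.not.to_comp.comp hcomp).of_eq fun c => Bool.not_not _, by simp⟩
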